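/- **Tree-adjoining grammars.** Fix finite sets $\mathcal T$ of terminals and $\mathcal N$ of non-terminals. Trees are finite, rooted and ordered; the root is not a leaf; the root and the inner nodes (those that are neither the root nor leaves) are labelled with non-terminals, and inner nodes may be marked for adjunction. In an *initial tree* every leaf is labelled with a terminal; in an *auxiliary tree* exactly one leaf, the foot node, is labelled with a non-terminal, namely the label of the root, and all other leaves are labelled with terminals. If $v$ is a marked node of a tree $t$ and $a$ is an auxiliary tree whose root has the same label as $v$, then *adjoining* $a$ at $v$ replaces $v$ by $a$, with the former subtree of $v$ in the place of the foot node of $a$ (the root of this subtree is no longer marked). A tree-adjoining grammar $\Gamma$ consists of a finite set of initial trees and a finite set of auxiliary trees. Its language $L(\Gamma)$ is the set of all strings that are obtained by reading the leaves, from left to right, of a tree without marked nodes that arises from an initial tree of $\Gamma$ by repeatedly adjoining auxiliary trees of $\Gamma$. **Machine model.** Algorithms are programs for a random access machine with words of $O(\log n)$ bits on inputs of size $n$ (that is, all numbers that occur are at most $(n+2)^{c}$ for a constant $c$), with unit-cost arithmetic and bitwise operations, comparisons and indirect memory access. A string of length $n$ has size $n$ and is given with one symbol per memory cell. A graph on $n$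 vertices has size $n$ and is given by its adjacency matrix. The problem $m$-Clique asks whether a graph has $m$ pairwise adjacent vertices. **Theorem.** There is a tree-adjoining grammar $\Gamma$ (of constant size: it is one fixed grammar, which serves all $k$ and all inputs) such that for every integer $k\ge 1$ the following holds. If strings of length $n$ can be tested for membership in $L(\Gamma)$ in time $T(n)$, where $T:\mathbb N\to\mathbb N$ is non-decreasing and $T(n)=\Omega(n)$, then $6k$-Clique on graphs with $n$ vertices can be solved in time $O\big(T(n^{k+1}\lfloor\log_2 n\rfloor)\big)$, where the constant may depend on $k$, on $T$ and on the membership algorithm. The reduction is combinatorial in the following sense. For each $k\ge 1$ there is a single program $R$, independent of $T$ and of the membership algorithm, whose only arithmetic operations are additions and subtractions, and which on every graph $G$ with $n$ vertices computes, in time $O(n^{k+1}\log n)$, a string $s_G$ of length $O(n^{k+1}\log n)$ such that $s_G\in L(\Gamma)$ if and only if $G$ contains a $6k$-clique. The $6k$-Clique algorithm of the theorem is $R$ followed by one run of the given membership algorithm, unchanged, on $s_G$. -/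

import Mathlib

open Filter Asymptotics

/-! ### Tree-adjoining grammars -/

namespace TreeAdj

/-- Finite ordered trees over terminals `T` and non-terminals `N`.
`term a` is a leaf labelled with a terminal, `foot A` is a leaf labelled with a non-terminal, and
`node A m ts` is a non-leaf node labelled `A` with children `ts` (from left to right), which is
marked for adjunction iff `m = true`. -/
inductive Tree (T N : Type) : Type
  | term (a : T) : Tree T N
  | foot (A : N) : Tree T N
  | node (A : N) (marked : Bool) (children : List (Tree T N)) : Tree T N

namespace Tree

variable {T N : Type}

/-- The labels of the leaves that carry a terminal, read from left to right. -/
def yield : Tree T N → List T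
  | term a => [a]
  | foot _ => []
  | node _ _ ts => ts.flatMap (fun t => t.yield)

/-- The labels of the leaves that carry a non-terminal, read from left to right. -/
def feet : Tree T N → List N
  | term _ => []
  | foot A => [A]
  | node _ _ ts => ts.flatMap (fun t => t.feet)

/-- Every `node` has at least one child, so that the leaves are exactly `term` and `foot`. -/
def Proper : Tree T N → Prop
  | term _ => True
  | foot _ => True
  | node _ _ ts => ts ≠ [] ∧ ∀ t ∈ ts, t.Proper

/-- No node is marked for adjunction. -/
def Unmarked : Tree T N → Prop
  | term _ => True
  | foot _ => True
  | node _ m ts => m = false ∧ ∀ t ∈ ts, t.Unmarked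

/-- `t.substFoot s` is `t` with its foot node replaced by the tree `s` (used for trees `t` with
exactly one foot node). -/
def substFoot : Tree T N → Tree T N → Tree T N
  | term a, _ => term a
  | foot _, s => s
  | node A m ts, s => node A m (ts.map (fun t => t.substFoot s))

/-- `t` is an initial tree: the root is a non-leaf that is not marked for adjunction, and every
leaf is labelled with a terminal. -/
def IsInitial (t : Tree T N) : Prop :=
  t.Proper ∧ t.feet = [] ∧ ∃ A ts, t = node A false ts

/-- `t` is an auxiliary tree with root label `A`: the root is a non-leaf labelled `A` that is not
marked for adjunction, exactly one leaf (the foot node) carries a non-terminal, namely `A`, and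
every other leaf is labelled with a terminal. -/
def IsAuxiliaryWith (A : N) (t : Tree T N) : Prop :=
  t.Proper ∧ t.feet = [A] ∧ ∃ ts, t = node A false ts

/-- `Adjoin a t t'`: the tree `t'` arises from `t` by adjoining the auxiliary tree `a` at one node
of `t` that is marked for adjunction and has the same label as the root of `a`. The node is
replaced by `a`, with the former subtree of the node in the place of the foot node; the node has
been used up, so its copy below is no longer marked. -/
inductive Adjoin (a : Tree T N) : Tree T N → Tree T N → Prop
  | here (A : N) (ts : List (Tree T N)) (h : a.IsAuxiliaryWith A) :
      Adjoin a (node A true ts) (a.substFoot (node A false ts))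
  | inside (A : N) (m : Bool) (l r : List (Tree T N)) (t t' : Tree T N) (h : Adjoin a t t') :
      Adjoin a (node A m (l ++ t :: r)) (node A m (l ++ t' :: r))

end Tree

/-- A tree-adjoining grammar with terminals `T` and non-terminals `N`. -/
structure TAG (T N : Type) where
  initialTrees : Set (Tree T N)
  auxiliaryTrees : Set (Tree T N)
  finite_initialTrees : initialTrees.Finite
  finite_auxiliaryTrees : auxiliaryTrees.Finite
  isInitial : ∀ t ∈ initialTrees, t.IsInitial
  isAuxiliary : ∀ t ∈ auxiliaryTrees, ∃ A, t.IsAuxiliaryWith A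

namespace TAG

variable {T N : Type}

/-- The derived trees: start with an initial tree and repeatedly adjoin auxiliary trees. -/
inductive Derived (Γ : TAG T N) : Tree T N → Prop
  | start (t : Tree T N) (h : t ∈ Γ.initialTrees) : Derived Γ t
  | adjoin (t t' a : Tree T N) (h : Derived Γ t) (ha : a ∈ Γ.auxiliaryTrees)
      (hadj : Tree.Adjoin a t t') : Derived Γ t'

/-- The language of a grammar: the yields of the derived trees without marked nodes. -/
def language (Γ : TAG T N) : Language T :=
  {s | ∃ t, Γ.Derived t ∧ t.Unmarked ∧ t.yield = s}

end TAG

end TreeAdj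

/-! ### Random access machines with words of logarithmic length -/

namespace RAM

/-- The binary word operations. -/
inductive BinOp : Type
  | add | sub | mul | div | mod | land | lor | xor | shiftLeft | shiftRight

/-- The value of a binary operation; subtraction is truncated at `0`. -/
def BinOp.eval : BinOp → ℕ → ℕ → ℕ
  | add, x, y => x + y
  | sub, x, y => x - y
  | mul, x, y => x * y
  | div, x, y => x / y
  | mod, x, y => x % y
  | land, x, y => x &&& y
  | lor, x, y => x ||| y
  | xor, x, y => x ^^^ y
  | shiftLeft, x, y => x <<< y
  | shiftRight, x, y => x >>> y

/-- The instructions. `d`, `a`, `b` are names of registers, `v` is a constant and `t` is the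
position in the program that a jump leads to. -/
inductive Instr : Type
  /-- register `d` gets the value `v` -/
  | const (d v : ℕ)
  /-- register `d` gets the value of `o` at the contents of registers `a` and `b` -/
  | op (o : BinOp) (d a b : ℕ)
  /-- register `d` gets the content of the memory cell whose address is in register `a` -/
  | load (d a : ℕ)
  /-- the memory cell whose address is in register `a` gets the content of register `b` -/
  | store (a b : ℕ)
  /-- jump to `t` if the content of register `a` is less than that of register `b` -/
  | jumpLt (a b t : ℕ)
  /-- jump to `t` if registers `a` and `b` have the same content -/
  | jumpEq (a b t : ℕ)

/-- A program is a finite list of instructions. -/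
abbrev Program : Type := List Instr

/-- A configuration: program counter, registers and memory. -/
structure Config : Type where
  pc : ℕ
  reg : ℕ → ℕ
  mem : ℕ → ℕ

/-- Execute one instruction. -/
def Instr.exec (i : Instr) (c : Config) : Config :=
  match i with
  | const d v => ⟨c.pc + 1, Function.update c.reg d v, c.mem⟩
  | op o d a b => ⟨c.pc + 1, Function.update c.reg d (o.eval (c.reg a) (c.reg b)), c.mem⟩
  | load d a => ⟨c.pc + 1, Function.update c.reg d (c.mem (c.reg a)), c.mem⟩
  | store a b => ⟨c.pc + 1, c.reg, Function.update c.mem (c.reg a) (c.reg b)⟩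
  | jumpLt a b t => ⟨if c.reg a < c.reg b then t else c.pc + 1, c.reg, c.mem⟩
  | jumpEq a b t => ⟨if c.reg a = c.reg b then t else c.pc + 1, c.reg, c.mem⟩

/-- Change the target of a jump. -/
def Instr.mapTarget (f : ℕ → ℕ) : Instr → Instr
  | jumpLt a b t => jumpLt a b (f t)
  | jumpEq a b t => jumpEq a b (f t)
  | i => i

/-- The only arithmetic operations that the instruction uses are addition and subtraction. -/
def Instr.IsAdditive : Instr → Prop
  | op o _ _ _ => o = BinOp.add ∨ o = BinOp.sub
  | _ => True

namespace Program

/-- The program has halted: the program counter has left the program. -/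
def Halted (P : Program) (c : Config) : Prop := P.length ≤ c.pc

/-- One step of the program; a halted configuration stays as it is. -/
def step (P : Program) (c : Config) : Config :=
  match P[c.pc]? with
  | some i => i.exec c
  | none => c

/-- The configuration after `j` steps. -/
def run (P : Program) (j : ℕ) (c : Config) : Config := P.step^[j] c

/-- Run `P`, and when it halts run `Q` on the registers and the memory that `P` has left. -/
def andThen (P Q : Program) : Program :=
  P.map (Instr.mapTarget (fun t => min t P.length)) ++
    Q.map (Instr.mapTarget (fun t => P.length + t))

/-- Every arithmetic operation in the program is an addition or a subtraction. -/
def IsAdditive (P : Program) : Prop := ∀ i ∈ P, i.IsAdditive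

end Program

/-- All registers and memory cells hold numbers that are at most `B`. -/
def Config.BoundedBy (c : Config) (B : ℕ) : Prop :=
  (∀ i, c.reg i ≤ B) ∧ ∀ a, c.mem a ≤ B

/-- A way to hand the objects of a type `α` to a machine: the parameter in which running times are
measured, and the contents of the registers and of the memory at the start. -/
structure Input (α : Type) where
  size : α → ℕ
  reg : α → ℕ → ℕ
  mem : α → ℕ → ℕ

/-- The starting configuration for the input `x`. -/
def Input.config {α : Type} (e : Input α) (x : α) : Config := ⟨0, e.reg x, e.mem x⟩

/-- The words have length `O(log n)`: there is a constant `c` such that all numbers that occur when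
`P` runs on an input of size `n` are at most `(n + 2) ^ c`. -/
def Program.HasLogWords {α : Type} (P : Program) (e : Input α) : Prop :=
  ∃ c : ℕ, ∀ x j, (P.run j (e.config x)).BoundedBy ((e.size x + 2) ^ c)

open Classical in
/-- `P` decides the set `A` of inputs, in at most `t n` steps on inputs of size `n`: the answer,
`1` for yes and `0` for no, is the content of register `0` when `P` halts. -/
def Program.DecidesInTime {α : Type} (P : Program) (e : Input α) (A : Set α) (t : ℕ → ℕ) : Prop :=
  P.HasLogWords e ∧ ∀ x, P.Halted (P.run (t (e.size x)) (e.config x)) ∧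
    (P.run (t (e.size x)) (e.config x)).reg 0 = if x ∈ A then 1 else 0

/-- `P` computes the function `f`, in at most `t n` steps on inputs of size `n`: when `P` halts,
the registers and the memory are those of the input `f x`. -/
def Program.ComputesInTime {α β : Type} (P : Program) (e : Input α) (e' : Input β) (f : α → β)
    (t : ℕ → ℕ) : Prop :=
  P.HasLogWords e ∧ ∀ x, P.Halted (P.run (t (e.size x)) (e.config x)) ∧
    (P.run (t (e.size x)) (e.config x)).reg = e'.reg (f x) ∧
    (P.run (t (e.size x)) (e.config x)).mem = e'.mem (f x)

/-- A string over the alphabet `{0, …, q - 1}`: its length is in register `0` and its symbols are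
in the memory cells `0, 1, 2, …`, one symbol per cell; all else is `0`. -/
def stringInput (q : ℕ) : Input (List (Fin q)) where
  size s := s.length
  reg s i := if i = 0 then s.length else 0
  mem s a := (s.map (fun x => (x : ℕ))).getD a 0

/-- The finite graphs, on the vertex sets `{0, …, n - 1}`. -/
abbrev Graph : Type := Σ n : ℕ, SimpleGraph (Fin n)

open Classical in
/-- A graph with `n` vertices: `n` is in register `0` and the adjacency matrix is in the memory
cells `0, …, n ^ 2 - 1`, row by row; all else is `0`. The size is the number of vertices. -/
noncomputable def graphInput : Input Graph where
  size G := G.1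
  reg G i := if i = 0 then G.1 else 0
  mem G a := if ∃ u v : Fin G.1, a = u * G.1 + v ∧ G.2.Adj u v then 1 else 0

/-- The yes-instances of `m`-Clique: the graphs with `m` pairwise adjacent vertices. -/
def cliqueProblem (m : ℕ) : Set Graph := {G | ∃ S : Finset (Fin G.1), G.2.IsNClique m S}

end RAM

/-!
The grammar reads a string that consists of one gadget `[ π(v) ; π(v) ]` for every `k`-tuple `v`
of vertices, and selects six gadgets that belong to tuples forming a `6 * k`-clique.

The vector of `v` has one symbol for every vertex `i`. The symbol says whether `i` is adjacent to
all entries of `v`, or is an entry of `v` that is adjacent to all other entries, or is an entry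
and is not adjacent to all others (a symbol compatible with none). Six tuples make up a
`6 * k`-clique if and only if the vectors of any two of them are compatible at every vertex:
nowhere an entry of one tuple meets a vertex that is not adjacent to all entries of the other
(`mem_cliqueProblem_of_joined`, `exists_joined_of_mem_cliqueProblem`).

An auxiliary tree contributes a pair of strings `(x, y)`, left and right of its foot node, and a
pair can grow at its four ends at once. Growth by pairwise compatible symbols compares the vectors
of four tuples, those at which the four ends are. If a pair compares the tuples `1`, `2`, `5`, `6`
and a second one, nested into it, compares `2`, `3`, `4`, `5`, then the combined pair has its ends
at `1`, `3`, `4`, `6`, and the third comparison, of these four, completes the list of the fifteen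
pairs of tuples. Each selected tuple takes part in two comparisons, hence the two copies of its
vector; these are palindromes because the ends grow in different directions. This is
`exists_joined_of_mem_language` and `mem_language_of_joined`; the language is computed in
`CliqueTAG.mem_language_iff`, from a general description of derivations by pairs of strings
(`TAG.Closed.exists_mem_sem`, `TAG.closed_pairs`).

Since adjacency is written as a vector and not as a list of vertex numbers, the string has length
`n ^ k * (4 * n + 3)`, which is eventually below `n ^ (k + 1) * Nat.log 2 n`. That there is no
constant factor is what allows `T` to grow arbitrarily fast.

The reduction program moves the adjacency matrix behind the place of the output, enumerates the
tuples by `k` nested loops and computes each symbol from a sum of `k` entries of the matrix, whose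
diagonal is set to `k + 1` to tell the entries of a tuple from other vertices. It is verified with
a calculus of total correctness, `Program.WP`, that keeps track of the running time and of the
size of all numbers; the result is `wp_reduction`.
-/

/-! ### Derivations of a tree-adjoining grammar as wrappings of words -/

namespace TreeAdj

namespace Tree

variable {T N : Type}

theorem induct {p : Tree T N → Prop} (term : ∀ a, p (term a)) (foot : ∀ A, p (foot A))
    (node : ∀ A m ts, (∀ t ∈ ts, p t) → p (node A m ts)) : ∀ t, p t
  | .term a => term a
  | .foot A => foot A
  | .node A m ts => node A m ts (fun t _ => induct term foot node t)

/-- The leaves of a tree from left to right, with `none` for every leaf that carries a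
non-terminal. -/
def word : Tree T N → List (Option T)
  | term a => [some a]
  | foot _ => [none]
  | node _ _ ts => ts.flatMap (fun t => t.word)

/-- All words `x v y` with `(x, y)` in the relation `L` and `v` in the language `K`. -/
def wrap (L : List T → List T → Prop) (K : Language (Option T)) : Language (Option T) :=
  {u | ∃ x y v, L x y ∧ v ∈ K ∧ u = x.map some ++ v ++ y.map some}

/-- The words that the tree yields when at every marked node, labelled `A`, the yield of the subtree
is wrapped into some pair of the relation `W A`. -/
def sem (W : N → List T → List T → Prop) : Tree T N → Language (Option T)
  | term a => {[some a]}
  | foot _ => {[none]}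
  | node A true ts => wrap (W A) (ts.map (fun t => t.sem W)).prod
  | node _ false ts => (ts.map (fun t => t.sem W)).prod

theorem mem_sem_term {W : N → List T → List T → Prop} {a : T} {u : List (Option T)} :
    u ∈ (term a : Tree T N).sem W ↔ u = [some a] := by
  simp only [sem]
  rfl

theorem mem_sem_foot {W : N → List T → List T → Prop} {A : N} {u : List (Option T)} :
    u ∈ (foot A : Tree T N).sem W ↔ u = [none] := by
  simp only [sem]
  rfl

/-- The words that arise from `w` when every `none` is replaced by some word of `K`. -/
def plug (K : Language (Option T)) (w : List (Option T)) : Language (Option T) :=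
  (w.map (fun o => o.elim K (fun a => ({[some a]} : Language (Option T))))).prod

theorem plug_append (K : Language (Option T)) (w w' : List (Option T)) :
    plug K (w ++ w') = plug K w * plug K w' := by
  simp [plug]

theorem plug_map_some (K : Language (Option T)) (x : List T) :
    plug K (x.map some) = {x.map some} := by
  induction x with
  | nil => rfl
  | cons a x ih =>
    have : plug K ((a :: x).map some) = {[some a]} * plug K (x.map some) := by simp [plug]
    rw [this, ih]
    ext u
    simp only [Language.mem_mul]
    constructor
    · rintro ⟨_, rfl, _, rfl, rfl⟩
      rfl
    · rintro rfl
      exact ⟨_, rfl, _, rfl, rfl⟩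

theorem exists_mem_sem_of_substFoot (W : N → List T → List T → Prop) (s t : Tree T N) :
    ∀ u ∈ (t.substFoot s).sem W, ∃ w ∈ t.sem W, u ∈ plug (s.sem W) w := by
  induction t using induct with
  | term a =>
    intro u hu
    refine ⟨[some a], mem_sem_term.2 rfl, ?_⟩
    simpa [substFoot, sem, plug] using hu
  | foot A =>
    intro u hu
    refine ⟨[none], mem_sem_foot.2 rfl, ?_⟩
    simpa [substFoot, plug] using hu
  | node A m ts ih =>
    have key : ∀ u ∈ (ts.map (fun t => (t.substFoot s).sem W)).prod,
        ∃ w ∈ (ts.map (fun t => t.sem W)).prod, u ∈ plug (s.sem W) w := by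
      induction ts with
      | nil =>
        intro u hu
        exact ⟨[], rfl, by simpa [plug] using hu⟩
      | cons t ts ih' =>
        intro u hu
        simp only [List.map_cons, List.prod_cons, Language.mem_mul] at hu ⊢
        obtain ⟨u₁, h₁, u₂, h₂, rfl⟩ := hu
        obtain ⟨w₁, hw₁, hu₁⟩ := ih t (by simp) u₁ h₁
        obtain ⟨w₂, hw₂, hu₂⟩ := ih' (fun t ht => ih t (by simp [ht])) u₂ h₂
        refine ⟨w₁ ++ w₂, ⟨w₁, hw₁, w₂, hw₂, rfl⟩, ?_⟩
        rw [plug_append]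
        exact ⟨u₁, hu₁, u₂, hu₂, rfl⟩
    intro u hu
    cases m with
    | false =>
      simp only [substFoot, sem, List.map_map] at hu ⊢
      exact key u hu
    | true =>
      simp only [substFoot, sem, List.map_map] at hu ⊢
      obtain ⟨x, y, v, hxy, hv, rfl⟩ := hu
      obtain ⟨w, hw, hvw⟩ := key v hv
      refine ⟨_, ⟨x, y, w, hxy, hw, rfl⟩, ?_⟩
      rw [plug_append, plug_append, plug_map_some, plug_map_some]
      exact ⟨_, ⟨_, rfl, _, hvw, rfl⟩, _, rfl, rfl⟩

theorem countP_isNone_of_mem_sem (W : N → List T → List T → Prop) (t : Tree T N) :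
    ∀ u ∈ t.sem W, u.countP Option.isNone = t.feet.length := by
  induction t using induct with
  | term a =>
    intro u hu
    simp [mem_sem_term.1 hu, feet]
  | foot A =>
    intro u hu
    simp [mem_sem_foot.1 hu, feet]
  | node A m ts ih =>
    have key : ∀ u ∈ (ts.map (fun t => t.sem W)).prod,
        u.countP Option.isNone = (ts.flatMap (fun t => t.feet)).length := by
      induction ts with
      | nil =>
        intro u hu
        have : u = [] := by simpa using hu
        simp [this]
      | cons t ts ih' =>
        intro u hu
        simp only [List.map_cons, List.prod_cons, Language.mem_mul] at hu
        obtain ⟨u₁, h₁, u₂, h₂, rfl⟩ := hu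
        rw [List.countP_append, ih t (by simp) u₁ h₁,
          ih' (fun t ht => ih t (by simp [ht])) u₂ h₂]
        simp
    intro u hu
    cases m with
    | false =>
      simp only [sem, feet] at hu ⊢
      exact key u hu
    | true =>
      simp only [sem, feet] at hu ⊢
      obtain ⟨x, y, v, hxy, hv, rfl⟩ := hu
      rw [List.countP_append, List.countP_append, key v hv]
      simp [Function.comp_def]

theorem eq_map_some_of_countP_eq_zero (u : List (Option T)) (h : u.countP Option.isNone = 0) :
    u = u.reduceOption.map some := by
  induction u with
  | nil => rfl
  | cons o u ih =>
    cases o with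
    | none => simp at h
    | some a =>
      rw [List.countP_cons] at h
      simp only [List.reduceOption_cons_of_some, List.map_cons]
      rw [← ih (by omega)]

theorem exists_eq_of_countP_eq_one (u : List (Option T)) (h : u.countP Option.isNone = 1) :
    ∃ x y : List T, u = x.map some ++ none :: y.map some := by
  induction u with
  | nil => simp at h
  | cons o u ih =>
    cases o with
    | none =>
      refine ⟨[], u.reduceOption, ?_⟩
      rw [← eq_map_some_of_countP_eq_zero u (by simpa using h)]
      rfl
    | some a =>
      obtain ⟨x, y, rfl⟩ := ih (by simpa using h)
      exact ⟨a :: x, y, rfl⟩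

theorem word_mem_sem (W : N → List T → List T → Prop) (t : Tree T N) :
    t.Unmarked → t.word ∈ t.sem W := by
  induction t using induct with
  | term a => exact fun _ => mem_sem_term.2 (by simp [word])
  | foot A => exact fun _ => mem_sem_foot.2 (by simp [word])
  | node A m ts ih =>
    intro h
    simp only [Unmarked] at h
    obtain ⟨rfl, h⟩ := h
    simp only [word, sem]
    induction ts with
    | nil => simp
    | cons t ts ih' =>
      simp only [List.map_cons, List.prod_cons, List.flatMap_cons]
      exact ⟨_, ih t (by simp) (h t (by simp)), _,
        ih' (fun t ht => ih t (by simp [ht])) (fun t ht => h t (by simp [ht])), rfl⟩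

theorem reduceOption_word (t : Tree T N) : t.word.reduceOption = t.yield := by
  induction t using induct with
  | term a => simp [word, yield]
  | foot A => simp [word, yield]
  | node A m ts ih =>
    simp only [word, yield]
    induction ts with
    | nil => rfl
    | cons t ts ih' =>
      simp only [List.flatMap_cons, List.reduceOption_append]
      rw [ih t (by simp), ih' (fun t ht => ih t (by simp [ht]))]

theorem word_substFoot (s t : Tree T N) :
    (t.substFoot s).word = t.word.flatMap (fun o => o.elim s.word (fun a => [some a])) := by
  induction t using induct with
  | term a => simp [substFoot, word]
  | foot A => simp [substFoot, word]
  | node A m ts ih =>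
    simp only [substFoot, word, List.flatMap_map, List.flatMap_assoc]
    induction ts with
    | nil => rfl
    | cons t ts ih' =>
      simp only [List.flatMap_cons]
      rw [ih t (by simp), ih' (fun t ht => ih t (by simp [ht]))]

theorem substFoot_assoc (r s t : Tree T N) :
    (t.substFoot s).substFoot r = t.substFoot (s.substFoot r) := by
  induction t using induct with
  | term a => simp [substFoot]
  | foot A => simp [substFoot]
  | node A m ts ih =>
    simp only [substFoot, List.map_map, node.injEq, true_and]
    exact List.map_congr_left ih

theorem substFoot_of_feet_eq_nil (s t : Tree T N) : t.feet = [] → t.substFoot s = t := by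
  induction t using induct with
  | term a => simp [substFoot]
  | foot A => simp [feet]
  | node A m ts ih =>
    intro h
    simp only [feet, List.flatMap_eq_nil_iff] at h
    simp only [substFoot, node.injEq, true_and]
    exact (List.map_congr_left (fun t ht => ih t ht (h t ht))).trans
      (List.map_id'' (fun _ => rfl) ts)

theorem unmarked_substFoot (s t : Tree T N) (hs : s.Unmarked) :
    t.Unmarked → (t.substFoot s).Unmarked := by
  induction t using induct with
  | term a => simp [substFoot, Unmarked]
  | foot A => simp [substFoot, hs]
  | node A m ts ih =>
    intro h
    simp only [Unmarked, substFoot, List.mem_map, forall_exists_index, and_imp,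
      forall_apply_eq_imp_iff₂] at h ⊢
    exact ⟨h.1, fun t ht => ih t ht (h.2 t ht)⟩

end Tree

namespace TAG

variable {T N : Type} (Γ : TAG T N)

/-- The relations `W A` are closed under the auxiliary trees of the grammar: a pair that an
auxiliary tree with root label `A` contributes is in `W A`. -/
def Closed (W : N → List T → List T → Prop) : Prop :=
  ∀ a ∈ Γ.auxiliaryTrees, ∀ A, a.IsAuxiliaryWith A → ∀ x y : List T,
    x.map some ++ none :: y.map some ∈ a.sem W → W A x y

variable {Γ}

/-- Adjunction can be undone on the level of words: whatever `t'` yields was already counted among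
the words of `t`, with the marked node wrapped into the pair of the adjoined tree. -/
theorem Closed.sem_subset {W : N → List T → List T → Prop} (hW : Γ.Closed W) {a t t' : Tree T N}
    (ha : a ∈ Γ.auxiliaryTrees) (h : Tree.Adjoin a t t') : t'.sem W ≤ t.sem W := by
  induction h with
  | here A ts hA =>
    intro u hu
    obtain ⟨w, hw, huw⟩ := Tree.exists_mem_sem_of_substFoot W _ _ u hu
    have hc := Tree.countP_isNone_of_mem_sem W a w hw
    rw [hA.2.1] at hc
    obtain ⟨x, y, rfl⟩ := Tree.exists_eq_of_countP_eq_one w hc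
    have hxy := hW a ha A hA x y hw
    rw [Tree.plug_append, Tree.plug_map_some] at huw
    have h2 : Tree.plug ((Tree.node A false ts).sem W) (none :: y.map some) =
        (Tree.node A false ts).sem W * {y.map some} := by
      rw [← Tree.plug_map_some ((Tree.node A false ts).sem W) y]
      simp [Tree.plug]
    rw [h2] at huw
    obtain ⟨_, rfl, _, ⟨v, hv, _, rfl, rfl⟩, rfl⟩ := huw
    simp only [Tree.sem] at hv ⊢
    exact ⟨x, y, v, hxy, hv, by simp⟩
  | inside A m l r t t' h ih =>
    have key : ((l ++ t' :: r).map (fun t => t.sem W)).prod ≤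
        ((l ++ t :: r).map (fun t => t.sem W)).prod := by
      simp only [List.map_append, List.map_cons, List.prod_append, List.prod_cons]
      rintro u ⟨u₁, h₁, _, ⟨u₂, h₂, u₃, h₃, rfl⟩, rfl⟩
      exact ⟨u₁, h₁, _, ⟨u₂, ih h₂, u₃, h₃, rfl⟩, rfl⟩
    cases m with
    | false => simpa only [Tree.sem] using key
    | true =>
      simp only [Tree.sem]
      rintro u ⟨x, y, v, hxy, hv, rfl⟩
      exact ⟨x, y, v, hxy, key hv, rfl⟩

/-- Soundness: closed relations account for every word of the language. -/
theorem Closed.exists_mem_sem {W : N → List T → List T → Prop} (hW : Γ.Closed W) {s : List T}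
    (hs : s ∈ Γ.language) : ∃ t ∈ Γ.initialTrees, s.map some ∈ t.sem W := by
  obtain ⟨t, ht, hu, rfl⟩ := hs
  have key : ∀ u ∈ t.sem W, ∃ t₀ ∈ Γ.initialTrees, u ∈ t₀.sem W := by
    clear hu
    induction ht with
    | start t h => exact fun u hu => ⟨t, h, hu⟩
    | adjoin t t' a h ha hadj ih => exact fun u hu => ih u (hW.sem_subset ha hadj hu)
  obtain ⟨t₀, h₀, hm⟩ := key _ (Tree.word_mem_sem W t hu)
  refine ⟨t₀, h₀, ?_⟩
  have hc := Tree.countP_isNone_of_mem_sem W t₀ _ hm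
  rw [(Γ.isInitial t₀ h₀).2.1] at hc
  rwa [← Tree.reduceOption_word, ← Tree.eq_map_some_of_countP_eq_zero _ hc]

variable (Γ)

/-- `t'` arises from `t` by repeatedly adjoining auxiliary trees of the grammar. -/
def Steps : Tree T N → Tree T N → Prop :=
  Relation.ReflTransGen (fun t t' => ∃ a ∈ Γ.auxiliaryTrees, Tree.Adjoin a t t')

/-- The pairs `(x, y)` such that a marked node labelled `A` can be expanded, without a marked node
being left over, to a tree that yields `x` to the left and `y` to the right of the old subtree. -/
def Pairs (A : N) (x y : List T) : Prop :=
  ∃ b : Tree T N, b.Unmarked ∧ b.word = x.map some ++ none :: y.map some ∧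
    ∀ ts, Γ.Steps (.node A true ts) (b.substFoot (.node A false ts))

variable {Γ}

theorem Steps.node {t t' : Tree T N} (h : Γ.Steps t t') (A : N) (m : Bool)
    (l r : List (Tree T N)) : Γ.Steps (.node A m (l ++ t :: r)) (.node A m (l ++ t' :: r)) := by
  induction h with
  | refl => exact .refl
  | tail _ h ih =>
    obtain ⟨a, ha, hadj⟩ := h
    exact ih.tail ⟨a, ha, .inside A m l r _ _ hadj⟩

theorem Derived.steps {t t' : Tree T N} (h : Γ.Derived t) (hs : Γ.Steps t t') : Γ.Derived t' := by
  induction hs with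
  | refl => exact h
  | tail _ h' ih =>
    obtain ⟨a, ha, hadj⟩ := h'
    exact .adjoin _ _ a ih ha hadj

/-- Every word that a tree yields according to the pairs that the grammar can realize is the word
of a tree without marked nodes that can be derived from it. -/
theorem exists_steps_of_mem_sem (t : Tree T N) : ∀ u ∈ t.sem Γ.Pairs,
    ∃ t' : Tree T N, t'.Unmarked ∧ t'.word = u ∧ ∀ s, Γ.Steps (t.substFoot s) (t'.substFoot s) := by
  induction t using Tree.induct with
  | term a =>
    intro u hu
    exact ⟨.term a, by simp [Tree.Unmarked], by simp [Tree.word, Tree.mem_sem_term.1 hu],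
      fun s => .refl⟩
  | foot A =>
    intro u hu
    exact ⟨.foot A, by simp [Tree.Unmarked], by simp [Tree.word, Tree.mem_sem_foot.1 hu],
      fun s => .refl⟩
  | node A m ts ih =>
    have key : ∀ u ∈ (ts.map (fun t => t.sem Γ.Pairs)).prod,
        ∃ ts' : List (Tree T N), (∀ t ∈ ts', t.Unmarked) ∧
          ts'.flatMap (fun t => t.word) = u ∧
          ∀ s l, Γ.Steps (.node A m (l ++ ts.map (fun t => t.substFoot s)))
            (.node A m (l ++ ts'.map (fun t => t.substFoot s))) := by
      induction ts with
      | nil =>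
        intro u hu
        have : u = [] := by simpa using hu
        exact ⟨[], by simp, by simp [this], fun s l => .refl⟩
      | cons t ts ih' =>
        intro u hu
        simp only [List.map_cons, List.prod_cons, Language.mem_mul] at hu
        obtain ⟨u₁, h₁, u₂, h₂, rfl⟩ := hu
        obtain ⟨t', hu', hw', hs'⟩ := ih t (by simp) u₁ h₁
        obtain ⟨ts', hus, hws, hss⟩ := ih' (fun t ht => ih t (by simp [ht])) u₂ h₂
        refine ⟨t' :: ts', ?_, by simp [hw', hws], fun s l => ?_⟩
        · intro t₀ ht₀
          rcases List.mem_cons.1 ht₀ with rfl | ht₀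
          exacts [hu', hus t₀ ht₀]
        · refine ((hs' s).node A m l _).trans ?_
          have := hss s (l ++ [t'.substFoot s])
          simp only [List.append_assoc, List.singleton_append] at this
          exact this
    intro u hu
    cases m with
    | false =>
      simp only [Tree.sem] at hu
      obtain ⟨ts', h₁, h₂, h₃⟩ := key u hu
      refine ⟨.node A false ts', by simpa [Tree.Unmarked] using h₁, by simpa [Tree.word] using h₂,
        fun s => ?_⟩
      simpa [Tree.substFoot] using h₃ s []
    | true =>
      simp only [Tree.sem] at hu
      obtain ⟨x, y, v, ⟨b, hb₁, hb₂, hb₃⟩, hv, rfl⟩ := hu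
      obtain ⟨ts', h₁, h₂, h₃⟩ := key v hv
      refine ⟨b.substFoot (.node A false ts'), ?_, ?_, fun s => ?_⟩
      · exact Tree.unmarked_substFoot _ _ (by simpa [Tree.Unmarked] using h₁) hb₁
      · have hx : ∀ z : List T, (z.map some).flatMap
            (fun o => o.elim (Tree.node A false ts').word (fun a => [some a])) = z.map some := by
          intro z
          induction z with
          | nil => rfl
          | cons a z ih => simpa using ih
        rw [Tree.word_substFoot, hb₂, List.flatMap_append, List.flatMap_cons, hx, hx]
        simp [Tree.word, h₂]
      · rw [Tree.substFoot_assoc]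
        simp only [Tree.substFoot]
        exact (by simpa using h₃ s [] : Γ.Steps _ _).trans (hb₃ _)

/-- Completeness, for auxiliary trees. -/
theorem closed_pairs : Γ.Closed Γ.Pairs := by
  intro a ha A hA x y hxy
  obtain ⟨b, hb₁, hb₂, hb₃⟩ := exists_steps_of_mem_sem a _ hxy
  exact ⟨b, hb₁, hb₂, fun ts =>
    Relation.ReflTransGen.head ⟨a, ha, .here A ts hA⟩ (hb₃ (.node A false ts))⟩

/-- Completeness, for initial trees. -/
theorem mem_language_of_mem_sem {t : Tree T N} (ht : t ∈ Γ.initialTrees) {s : List T}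
    (hs : s.map some ∈ t.sem Γ.Pairs) : s ∈ Γ.language := by
  obtain ⟨b, hb₁, hb₂, hb₃⟩ := exists_steps_of_mem_sem t _ hs
  have hsub := Tree.substFoot_of_feet_eq_nil b t (Γ.isInitial t ht).2.1
  have hd := (Derived.start t ht).steps (hsub ▸ hb₃ b)
  refine ⟨_, hd, Tree.unmarked_substFoot _ _ hb₁ hb₁, ?_⟩
  have key : ∀ (w : List (Option T)) (z : List T), ((z.map some).flatMap
      (fun o => o.elim w (fun a => [some a]))).reduceOption = z := by
    intro w z
    induction z with
    | nil => rfl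
    | cons a z ih => simpa using ih
  rw [← Tree.reduceOption_word, Tree.word_substFoot, hb₂, key]

end TAG

end TreeAdj

/-! ### Auxiliary trees with one spine -/

namespace TreeAdj

namespace Tree

variable {T N : Type}

/-- The leaves for a terminal string. -/
def leaves (l : List T) : List (Tree T N) := l.map term

theorem flatMap_feet_leaves (l : List T) :
    (leaves l : List (Tree T N)).flatMap (fun t => t.feet) = [] := by
  simp [leaves, feet]

theorem proper_of_mem_leaves {l : List T} {t : Tree T N} (h : t ∈ leaves l) : t.Proper := by
  obtain ⟨a, _, rfl⟩ := List.mem_map.1 h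
  simp [Proper]

theorem prod_sem_leaves (W : N → List T → List T → Prop) (l : List T) :
    ((leaves l).map (fun t => t.sem W)).prod = {l.map some} := by
  induction l with
  | nil => rfl
  | cons a l ih =>
    simp only [leaves, List.map_cons, List.prod_cons] at ih ⊢
    rw [ih]
    ext u
    simp only [Language.mem_mul]
    constructor
    · rintro ⟨_, h, _, rfl, rfl⟩
      rw [mem_sem_term.1 h]
      rfl
    · rintro rfl
      exact ⟨_, mem_sem_term.2 rfl, _, rfl, rfl⟩

theorem mem_prod_sem_leaves_append_cons {W : N → List T → List T → Prop} {l r : List T}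
    {t : Tree T N} {u : List (Option T)} :
    u ∈ ((leaves l ++ t :: leaves r).map (fun t => sem W t)).prod ↔
      ∃ v ∈ t.sem W, u = l.map some ++ v ++ r.map some := by
  simp only [List.map_append, List.map_cons, List.prod_append, List.prod_cons, prod_sem_leaves,
    Language.mem_mul]
  constructor
  · rintro ⟨_, rfl, _, ⟨v, hv, _, rfl, rfl⟩, rfl⟩
    exact ⟨v, hv, by simp⟩
  · rintro ⟨v, hv, rfl⟩
    exact ⟨_, rfl, _, ⟨v, hv, _, rfl, rfl⟩, by simp⟩

theorem map_some_append_none_inj {x y x' y' : List T} :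
    x.map some ++ none :: y.map some = x'.map some ++ none :: y'.map some ↔ x = x' ∧ y = y' := by
  constructor
  · intro h
    rw [List.append_cons_inj_of_notMem (by simp) (by simp)] at h
    exact ⟨List.map_injective_iff.2 (Option.some_injective T) h.1,
      List.map_injective_iff.2 (Option.some_injective T) h.2.2⟩
  · rintro ⟨rfl, rfl⟩
    rfl

/-- The auxiliary tree with the pair `(l, r)` and no marked node. -/
def constTree (A : N) (l r : List T) : Tree T N :=
  node A false (leaves l ++ foot A :: leaves r)

/-- The auxiliary tree that turns the pairs `(x, y)` of `B` into the pairs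
`(l₁ x l₂, r₂ y r₁)` of `A`. -/
def growTree (A B : N) (l₁ l₂ r₂ r₁ : List T) : Tree T N :=
  node A false (leaves l₁ ++ node B true (leaves l₂ ++ foot A :: leaves r₂) :: leaves r₁)

/-- The auxiliary tree that turns two pairs `(x, y)` and `(x', y')` of `B` into the pair
`(e x e x' e, e y' e y e)` of `A`. -/
def nestTree (A B : N) (e : T) : Tree T N :=
  node A false (leaves [e] ++ node B true (leaves [e] ++
    node B true (leaves [e] ++ foot A :: leaves [e]) :: leaves [e]) :: leaves [e])

theorem proper_node {A : N} {m : Bool} {l r : List T} {t : Tree T N} (hp : t.Proper) :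
    (node A m (leaves l ++ t :: leaves r)).Proper := by
  simp only [Proper]
  refine ⟨by simp, fun s hs => ?_⟩
  rcases List.mem_append.1 hs with hs | hs
  · exact proper_of_mem_leaves hs
  · rcases List.mem_cons.1 hs with rfl | hs
    exacts [hp, proper_of_mem_leaves hs]

theorem feet_node {A : N} {m : Bool} {l r : List T} {t : Tree T N} :
    (node A m (leaves l ++ t :: leaves r)).feet = t.feet := by
  simp [feet, flatMap_feet_leaves]

theorem isAuxiliaryWith_constTree (A : N) (l r : List T) :
    (constTree A l r).IsAuxiliaryWith A :=
  ⟨proper_node (by simp [Proper]), by simp [constTree, feet_node, feet], _, rfl⟩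

theorem isAuxiliaryWith_growTree (A B : N) (l₁ l₂ r₂ r₁ : List T) :
    (growTree A B l₁ l₂ r₂ r₁).IsAuxiliaryWith A :=
  ⟨proper_node (proper_node (by simp [Proper])), by simp [growTree, feet_node, feet], _, rfl⟩

theorem isAuxiliaryWith_nestTree (A B : N) (e : T) : (nestTree A B e).IsAuxiliaryWith A :=
  ⟨proper_node (proper_node (proper_node (by simp [Proper]))),
    by simp only [nestTree, feet_node, feet], _, rfl⟩

variable {W : N → List T → List T → Prop} {A B : N} {x y : List T}

theorem mem_sem_constTree {l r : List T} :
    x.map some ++ none :: y.map some ∈ (constTree A l r).sem W ↔ x = l ∧ y = r := by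
  simp only [constTree, sem, mem_prod_sem_leaves_append_cons]
  rw [← map_some_append_none_inj]
  constructor
  · rintro ⟨v, hv, h⟩
    rw [h, show v = [none] from hv]
    simp
  · intro h
    exact ⟨[none], rfl, by rw [h]; simp⟩

theorem mem_sem_growTree {l₁ l₂ r₂ r₁ : List T} :
    x.map some ++ none :: y.map some ∈ (growTree A B l₁ l₂ r₂ r₁).sem W ↔
      ∃ x' y', W B x' y' ∧ x = l₁ ++ x' ++ l₂ ∧ y = r₂ ++ y' ++ r₁ := by
  simp only [growTree, sem, mem_prod_sem_leaves_append_cons]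
  simp only [← map_some_append_none_inj]
  constructor
  · rintro ⟨_, ⟨x', y', w, h, hw, rfl⟩, e⟩
    obtain ⟨v, hv, rfl⟩ := mem_prod_sem_leaves_append_cons.1 hw
    rw [mem_sem_foot] at hv
    exact ⟨x', y', h, by rw [e, hv]; simp⟩
  · rintro ⟨x', y', h, e⟩
    refine ⟨_, ⟨x', y', _, h, mem_prod_sem_leaves_append_cons.2 ⟨_, mem_sem_foot.2 rfl, rfl⟩, rfl⟩,
      ?_⟩
    rw [e]
    simp

theorem mem_sem_nestTree {e : T} :
    x.map some ++ none :: y.map some ∈ (nestTree A B e).sem W ↔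
      ∃ x₁ y₁ x₂ y₂, W B x₁ y₁ ∧ W B x₂ y₂ ∧
        x = e :: x₁ ++ e :: x₂ ++ [e] ∧ y = e :: y₂ ++ e :: y₁ ++ [e] := by
  simp only [nestTree, sem, mem_prod_sem_leaves_append_cons]
  simp only [← map_some_append_none_inj]
  constructor
  · rintro ⟨_, ⟨x₁, y₁, w, h₁, hw, rfl⟩, he⟩
    obtain ⟨v, hv, rfl⟩ := mem_prod_sem_leaves_append_cons.1 hw
    simp only [sem] at hv
    obtain ⟨x₂, y₂, w₂, h₂, hw₂, rfl⟩ := hv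
    obtain ⟨v, hv, rfl⟩ := mem_prod_sem_leaves_append_cons.1 hw₂
    rw [mem_sem_foot] at hv
    exact ⟨x₁, y₁, x₂, y₂, h₁, h₂, by rw [he, hv]; simp⟩
  · rintro ⟨x₁, y₁, x₂, y₂, h₁, h₂, he⟩
    have h : ([e].map some ++ (x₂.map some ++ ([e].map some ++ [none] ++ [e].map some) ++
        y₂.map some) ++ [e].map some : List (Option T)) ∈ ((leaves [e] ++ node B true
          (leaves [e] ++ foot A :: leaves [e]) :: leaves [e]).map (fun t => sem W t)).prod := by
      refine mem_prod_sem_leaves_append_cons.2 ⟨_, ?_, rfl⟩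
      simp only [sem]
      exact ⟨x₂, y₂, _, h₂, mem_prod_sem_leaves_append_cons.2 ⟨_, mem_sem_foot.2 rfl, rfl⟩, rfl⟩
    refine ⟨_, ⟨x₁, y₁, _, h₁, h, rfl⟩, ?_⟩
    rw [he]
    simp

end Tree

end TreeAdj

/-! ### The grammar -/

namespace CliqueTAG

open TreeAdj TreeAdj.Tree

/-- The terminals. `0`, `1`, `2`, `3` are the entries of the vector of a tuple of vertices `v`, at a
vertex `i`: `2` if `i` occurs in `v` and is adjacent to all other entries of `v`, `3` if it occurs
and is not; otherwise `1` if `i` is adjacent to all entries of `v`, and `0` if it is not.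
`4`, `5`, `6` are an opening bracket, a separator and a closing bracket. -/
abbrev Sym : Type := Fin 7

/-- The entries of two vectors at the same vertex can belong to tuples that form a clique. -/
def Compat (a b : Sym) : Prop := a ≤ 2 ∧ b ≤ 2 ∧ (a = 2 → b = 1) ∧ (b = 2 → a = 1)

/-- Four entries, one for each end of a pair of strings. -/
structure Quad : Type where
  a : Sym
  b : Sym
  c : Sym
  d : Sym

/-- The entries are pairwise compatible. -/
def Quad.Ok (z : Quad) : Prop :=
  Compat z.a z.b ∧ Compat z.a z.c ∧ Compat z.a z.d ∧ Compat z.b z.c ∧ Compat z.b z.d ∧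
    Compat z.c z.d

/-- The auxiliary tree that lets the pairs of `A` grow at all four ends. -/
def quadTree (A : Fin 4) (z : Quad) : Tree Sym (Fin 4) := growTree A A [z.a] [z.b] [z.c] [z.d]

/-- The grammar. Non-terminal `0` makes the pairs `(w [, w' [)` with `w`, `w'` arbitrary; `1` makes
`(] w [, ] w' [)` and lets it grow by compatible entries at the four ends; `2` nests two pairs
of `1`, with separators around them, and lets the result grow likewise; `3` adds brackets and
arbitrary strings. The initial tree puts a closing bracket between the two strings of a pair. -/
def grammar : TAG Sym (Fin 4) where
  initialTrees := {node 3 false (leaves [] ++ node 3 true (leaves [] ++ term 6 :: leaves []) ::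
    leaves [])}
  auxiliaryTrees := {constTree 0 [4] [4], growTree 1 0 [6] [] [6] [], nestTree 2 1 5,
      growTree 3 2 [4] [] [4] [6]} ∪
    (Set.range fun c => growTree 0 0 [c] [] [] []) ∪
    (Set.range fun c => growTree 0 0 [] [] [c] []) ∪
    (Set.range fun c => growTree 3 3 [c] [] [] []) ∪
    (Set.range fun c => growTree 3 3 [] [] [c] []) ∪
    (Set.range fun c => growTree 3 3 [] [] [] [c]) ∪ quadTree 1 '' {z | z.Ok} ∪
    quadTree 2 '' {z | z.Ok}
  finite_initialTrees := Set.finite_singleton _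
  finite_auxiliaryTrees := by
    have : Finite Quad := Finite.of_injective
      (fun z : Quad => (z.a, z.b, z.c, z.d)) (by rintro ⟨⟩ ⟨⟩ h; simpa using h)
    simp only [Set.finite_union]
    exact ⟨⟨⟨⟨⟨⟨⟨Set.toFinite _, Set.finite_range _⟩, Set.finite_range _⟩, Set.finite_range _⟩,
      Set.finite_range _⟩, Set.finite_range _⟩, (Set.toFinite _).image _⟩, (Set.toFinite _).image _⟩
  isInitial := by
    rintro t rfl
    exact ⟨proper_node (proper_node (by simp [Proper])), by simp only [feet_node, feet], _, _, rfl⟩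
  isAuxiliary := by
    rintro t (((((((h | ⟨c, rfl⟩) | ⟨c, rfl⟩) | ⟨c, rfl⟩) | ⟨c, rfl⟩) | ⟨c, rfl⟩) | ⟨z, hz, rfl⟩) |
      ⟨z, hz, rfl⟩)
    · rcases h with rfl | rfl | rfl | rfl
      exacts [⟨_, isAuxiliaryWith_constTree _ _ _⟩, ⟨_, isAuxiliaryWith_growTree _ _ _ _ _ _⟩,
        ⟨_, isAuxiliaryWith_nestTree _ _ _⟩, ⟨_, isAuxiliaryWith_growTree _ _ _ _ _ _⟩]
    all_goals exact ⟨_, isAuxiliaryWith_growTree _ _ _ _ _ _⟩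

/-- `(x, y)` arises from `(x', y')` by growth at the four ends, by compatible entries each time. -/
def Grown (x' y' x y : List Sym) : Prop :=
  ∃ zs : List Quad, (∀ z ∈ zs, z.Ok) ∧
    x = (zs.map Quad.a).reverse ++ x' ++ zs.map Quad.b ∧
    y = (zs.map Quad.c).reverse ++ y' ++ zs.map Quad.d

/-- The pairs of non-terminal `1`. -/
def Inner (x y : List Sym) : Prop := ∃ w w', Grown (6 :: w ++ [4]) (6 :: w' ++ [4]) x y

/-- The pairs of non-terminal `2`. -/
def Outer (x y : List Sym) : Prop :=
  ∃ x₁ y₁ x₂ y₂, Inner x₁ y₁ ∧ Inner x₂ y₂ ∧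
    Grown (5 :: x₁ ++ 5 :: x₂ ++ [5]) (5 :: y₂ ++ 5 :: y₁ ++ [5]) x y

theorem Grown.refl (x y : List Sym) : Grown x y x y := ⟨[], by simp, by simp, by simp⟩

theorem Grown.grow {x' y' x y : List Sym} (h : Grown x' y' x y) {z : Quad} (hz : z.Ok) :
    Grown x' y' ([z.a] ++ x ++ [z.b]) ([z.c] ++ y ++ [z.d]) := by
  obtain ⟨zs, h, rfl, rfl⟩ := h
  refine ⟨zs ++ [z], fun z' hz' => ?_, by simp, by simp⟩
  rcases List.mem_append.1 hz' with hz' | hz'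
  · exact h z' hz'
  · rwa [List.mem_singleton.1 hz']

/-- The pairs of all non-terminals. -/
def pairs (A : Fin 4) (x y : List Sym) : Prop :=
  if A = 0 then ∃ w w', x = w ++ [4] ∧ y = w' ++ [4]
  else if A = 1 then Inner x y
  else if A = 2 then Outer x y
  else ∃ u m u' x' y', Outer x' y' ∧ x = u ++ 4 :: x' ∧ y = m ++ 4 :: y' ++ 6 :: u'

theorem eq_of_isAuxiliaryWith {A B : Fin 4} {t : Tree Sym (Fin 4)} (h : t.IsAuxiliaryWith A)
    (h' : t.IsAuxiliaryWith B) : B = A := by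
  have := h.2.1.symm.trans h'.2.1
  simpa using this.symm

theorem closed_pairs : grammar.Closed pairs := by
  rintro t (((((((h | ⟨c, rfl⟩) | ⟨c, rfl⟩) | ⟨c, rfl⟩) | ⟨c, rfl⟩) | ⟨c, rfl⟩) | ⟨z, hz, rfl⟩) |
      ⟨z, hz, rfl⟩) A hA x y hxy
  · rcases h with rfl | rfl | rfl | rfl
    · obtain rfl := eq_of_isAuxiliaryWith (isAuxiliaryWith_constTree _ _ _) hA
      obtain ⟨rfl, rfl⟩ := mem_sem_constTree.1 hxy
      exact ⟨[], [], rfl, rfl⟩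
    · obtain rfl := eq_of_isAuxiliaryWith (isAuxiliaryWith_growTree _ _ _ _ _ _) hA
      obtain ⟨x', y', ⟨w, w', rfl, rfl⟩, rfl, rfl⟩ := mem_sem_growTree.1 hxy
      refine ⟨w, w', ?_⟩
      simpa using Grown.refl _ _
    · obtain rfl := eq_of_isAuxiliaryWith (isAuxiliaryWith_nestTree _ _ _) hA
      obtain ⟨x₁, y₁, x₂, y₂, h₁, h₂, rfl, rfl⟩ := mem_sem_nestTree.1 hxy
      exact ⟨x₁, y₁, x₂, y₂, h₁, h₂, Grown.refl _ _⟩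
    · obtain rfl := eq_of_isAuxiliaryWith (isAuxiliaryWith_growTree _ _ _ _ _ _) hA
      obtain ⟨x', y', h, rfl, rfl⟩ := mem_sem_growTree.1 hxy
      exact ⟨[], [], [], x', y', h, by simp, by simp⟩
  all_goals
    obtain rfl := eq_of_isAuxiliaryWith (isAuxiliaryWith_growTree _ _ _ _ _ _) hA
    obtain ⟨x', y', h, rfl, rfl⟩ := mem_sem_growTree.1 hxy
  · obtain ⟨w, w', rfl, rfl⟩ := h
    exact ⟨c :: w, w', by simp, by simp⟩
  · obtain ⟨w, w', rfl, rfl⟩ := h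
    exact ⟨w, c :: w', by simp, by simp⟩
  · obtain ⟨u, m, u', x', y', h, rfl, rfl⟩ := h
    exact ⟨c :: u, m, u', x', y', h, by simp, by simp⟩
  · obtain ⟨u, m, u', x', y', h, rfl, rfl⟩ := h
    exact ⟨u, c :: m, u', x', y', h, by simp, by simp⟩
  · obtain ⟨u, m, u', x', y', h, rfl, rfl⟩ := h
    exact ⟨u, m, u' ++ [c], x', y', h, by simp, by simp⟩
  · obtain ⟨w, w', h⟩ := h
    exact ⟨w, w', h.grow hz⟩
  · obtain ⟨x₁, y₁, x₂, y₂, h₁, h₂, h⟩ := h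
    exact ⟨x₁, y₁, x₂, y₂, h₁, h₂, h.grow hz⟩

section Completeness

theorem pairs_growTree {A B : Fin 4} {l₁ l₂ r₂ r₁ : List Sym}
    (h : growTree A B l₁ l₂ r₂ r₁ ∈ grammar.auxiliaryTrees) {x y : List Sym}
    (hxy : grammar.Pairs B x y) : grammar.Pairs A (l₁ ++ x ++ l₂) (r₂ ++ y ++ r₁) :=
  TAG.closed_pairs _ h A (isAuxiliaryWith_growTree _ _ _ _ _ _) _ _
    (mem_sem_growTree.2 ⟨x, y, hxy, rfl, rfl⟩)

theorem pairs_zero (w w' : List Sym) : grammar.Pairs 0 (w ++ [4]) (w' ++ [4]) := by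
  induction w with
  | cons c w ih =>
    simpa using pairs_growTree (l₁ := [c]) (l₂ := []) (r₂ := []) (r₁ := [])
      (by simp [grammar]) ih
  | nil =>
    induction w' with
    | cons c w' ih =>
      simpa using pairs_growTree (l₁ := []) (l₂ := []) (r₂ := [c]) (r₁ := [])
        (by simp [grammar]) ih
    | nil =>
      exact TAG.closed_pairs (constTree 0 [4] [4]) (by simp [grammar]) 0
        (isAuxiliaryWith_constTree _ _ _) _ _ (mem_sem_constTree.2 ⟨rfl, rfl⟩)

theorem pairs_of_grown {A : Fin 4}
    (h : quadTree A '' {z | z.Ok} ⊆ grammar.auxiliaryTrees) {x' y' x y : List Sym}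
    (hxy : Grown x' y' x y) (h' : grammar.Pairs A x' y') : grammar.Pairs A x y := by
  obtain ⟨zs, hzs, rfl, rfl⟩ := hxy
  induction zs using List.reverseRecOn with
  | nil =>
    simpa using h'
  | append_singleton zs z ih =>
    have := pairs_growTree (h ⟨z, hzs z (by simp), rfl⟩) (ih fun z hz => hzs z (by simp [hz]))
    simpa using this

theorem pairs_one {x y : List Sym} (h : Inner x y) : grammar.Pairs 1 x y := by
  obtain ⟨w, w', h⟩ := h
  refine pairs_of_grown (fun _ h => Or.inl (Or.inr h)) h ?_
  simpa using pairs_growTree (A := 1) (l₁ := [6]) (l₂ := []) (r₂ := [6]) (r₁ := [])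
    (by simp [grammar]) (pairs_zero w w')

theorem pairs_two {x y : List Sym} (h : Outer x y) : grammar.Pairs 2 x y := by
  obtain ⟨x₁, y₁, x₂, y₂, h₁, h₂, h⟩ := h
  refine pairs_of_grown (fun _ h => Or.inr h) h ?_
  exact TAG.closed_pairs (nestTree 2 1 5) (by simp [grammar]) 2 (isAuxiliaryWith_nestTree _ 1 _) _ _
    (mem_sem_nestTree.2 ⟨x₁, y₁, x₂, y₂, pairs_one h₁, pairs_one h₂, rfl, rfl⟩)

theorem pairs_three {x y : List Sym} (h : Outer x y) (u m u' : List Sym) :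
    grammar.Pairs 3 (u ++ 4 :: x) (m ++ 4 :: y ++ 6 :: u') := by
  induction u with
  | cons c u ih =>
    simpa using pairs_growTree (l₁ := [c]) (l₂ := []) (r₂ := []) (r₁ := [])
      (by simp [grammar]) ih
  | nil =>
    induction m with
    | cons c m ih =>
      simpa using pairs_growTree (l₁ := []) (l₂ := []) (r₂ := [c]) (r₁ := [])
        (by simp [grammar]) ih
    | nil =>
      induction u' using List.reverseRecOn with
      | append_singleton u' c ih =>
        simpa using pairs_growTree (l₁ := []) (l₂ := []) (r₂ := [])
          (r₁ := [c]) (by simp [grammar]) ih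
      | nil =>
        simpa using pairs_growTree (A := 3) (l₁ := [4]) (l₂ := []) (r₂ := [4]) (r₁ := [6])
          (by simp [grammar]) (pairs_two h)

end Completeness

theorem mem_sem_initialTree {W : Fin 4 → List Sym → List Sym → Prop} {s : List Sym} :
    s.map some ∈ (node 3 false (leaves [] ++ node 3 true (leaves [] ++ term 6 :: leaves []) ::
      leaves [])).sem W ↔ ∃ x y, W 3 x y ∧ s = x ++ 6 :: y := by
  simp only [sem, mem_prod_sem_leaves_append_cons]
  constructor
  · rintro ⟨_, ⟨x, y, w, h, hw, rfl⟩, e⟩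
    obtain ⟨v, hv, rfl⟩ := mem_prod_sem_leaves_append_cons.1 hw
    rw [mem_sem_term.1 hv] at e
    refine ⟨x, y, h, List.map_injective_iff.2 (Option.some_injective Sym) ?_⟩
    rw [e]
    simp
  · rintro ⟨x, y, h, rfl⟩
    exact ⟨_, ⟨x, y, _, h, mem_prod_sem_leaves_append_cons.2 ⟨_, mem_sem_term.2 rfl, rfl⟩, rfl⟩,
      by simp⟩

/-- The language of the grammar. -/
theorem mem_language_iff {s : List Sym} : s ∈ grammar.language ↔
    ∃ u m u' x y, Outer x y ∧ s = u ++ 4 :: x ++ 6 :: (m ++ 4 :: y ++ 6 :: u') := by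
  constructor
  · intro hs
    obtain ⟨t, rfl, ht⟩ := closed_pairs.exists_mem_sem hs
    obtain ⟨_, _, ⟨u, m, u', x, y, h, rfl, rfl⟩, rfl⟩ := mem_sem_initialTree.1 ht
    exact ⟨u, m, u', x, y, h, rfl⟩
  · rintro ⟨u, m, u', x, y, h, rfl⟩
    exact TAG.mem_language_of_mem_sem (t := _) rfl
      (mem_sem_initialTree.2 ⟨_, _, pairs_three h u m u', rfl⟩)

end CliqueTAG

/-! ### The string of a graph -/

namespace CliqueTAG

/-- All lists of `k` numbers below `n`, in lexicographic order. -/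
def tuples (n : ℕ) : ℕ → List (List ℕ)
  | 0 => [[]]
  | k + 1 => (List.range n).flatMap fun d => (tuples n k).map (d :: ·)

/-- The sum of the weights `wt d i` for the entries `d` of `v`. -/
def weight (wt : ℕ → ℕ → ℕ) (v : List ℕ) (i : ℕ) : ℕ := (v.map fun d => wt d i).sum

/-- The symbol for a weight. With weight `k + 1` on the diagonal, weight `1` for adjacent and
weight `0` for other vertices, `k` means that all of the `k` entries are adjacent to the vertex, and
`2 * k` that one of them is the vertex and the others are adjacent to it. -/
def symbol (k w : ℕ) : Sym :=
  if w < k then 0 else if w = k then 1 else if w = 2 * k then 2 else 3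

/-- The vector of symbols of the tuple `v`. -/
def half (wt : ℕ → ℕ → ℕ) (n k : ℕ) (v : List ℕ) : List Sym :=
  (List.range n).map fun i => symbol k (weight wt v i)

/-- The vector of the tuple `v`, made into a palindrome: the four ends of a pair grow in different
directions, and a palindrome is the same in both. -/
def vec (wt : ℕ → ℕ → ℕ) (n k : ℕ) (v : List ℕ) : List Sym :=
  half wt n k v ++ (half wt n k v).reverse

/-- The gadget of the tuple `v`. It holds two copies of the vector because every selected tuple
takes part in two of the three comparisons. -/
def gadget (wt : ℕ → ℕ → ℕ) (n k : ℕ) (v : List ℕ) : List Sym :=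
  4 :: vec wt n k v ++ 5 :: vec wt n k v ++ [6]

/-- The gadgets of all `k`-tuples. -/
def encode (wt : ℕ → ℕ → ℕ) (n k : ℕ) : List Sym := (tuples n k).flatMap (gadget wt n k)

/-- At every vertex, the symbols of `v` and `w` are compatible. -/
def Joined (wt : ℕ → ℕ → ℕ) (n k : ℕ) (v w : List ℕ) : Prop :=
  ∀ i < n, Compat (symbol k (weight wt v i)) (symbol k (weight wt w i))

variable {wt : ℕ → ℕ → ℕ} {n k : ℕ}

theorem mem_tuples {v : List ℕ} : v ∈ tuples n k ↔ v.length = k ∧ ∀ d ∈ v, d < n := by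
  induction k generalizing v with
  | zero =>
    simp only [tuples, List.mem_singleton, List.length_eq_zero_iff]
    constructor
    · rintro rfl
      simp
    · exact fun h => h.1
  | succ k ih =>
    simp only [tuples, List.mem_flatMap, List.mem_range, List.mem_map, ih]
    constructor
    · rintro ⟨d, hd, w, ⟨hw, hw'⟩, rfl⟩
      simpa [hw] using ⟨hd, hw'⟩
    · rintro ⟨h, h'⟩
      cases v with
      | nil => simp at h
      | cons d v =>
        exact ⟨d, h' d (by simp), v, ⟨by simpa using h, fun e he => h' e (by simp [he])⟩, rfl⟩

theorem length_tuples : (tuples n k).length = n ^ k := by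
  induction k with
  | zero => rfl
  | succ k ih => simp [tuples, List.length_flatMap, ih, pow_succ, mul_comm]

theorem length_gadget (v : List ℕ) : (gadget wt n k v).length = 4 * n + 3 := by
  simp [gadget, vec, half]
  omega

theorem length_encode : (encode wt n k).length = n ^ k * (4 * n + 3) := by
  simp [encode, List.length_flatMap, length_gadget, length_tuples]

theorem symbol_le (k w : ℕ) : symbol k w ≤ 3 := by
  unfold symbol
  split_ifs <;> decide

theorem symbol_eq_one_iff {w : ℕ} : symbol k w = 1 ↔ w = k := by
  unfold symbol
  split_ifs <;> simp <;> omega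

theorem symbol_eq_two_iff (hk : 1 ≤ k) {w : ℕ} : symbol k w = 2 ↔ w = 2 * k := by
  unfold symbol
  split_ifs <;> simp <;> omega

theorem le_of_mem_vec {v : List ℕ} {c : Sym} (hc : c ∈ vec wt n k v) : c ≤ 3 := by
  simp only [vec, half, List.mem_append, List.mem_reverse, or_self, List.mem_map] at hc
  obtain ⟨i, _, rfl⟩ := hc
  exact symbol_le _ _

theorem reverse_vec (v : List ℕ) : (vec wt n k v).reverse = vec wt n k v := by
  simp [vec]

theorem getElem?_vec (v : List ℕ) {i : ℕ} (hi : i < n) :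
    (vec wt n k v)[i]? = some (symbol k (weight wt v i)) := by
  rw [vec, List.getElem?_append_left (by simpa [half] using hi)]
  simp [half, hi]

theorem append_eq_append_cons_of_notMem {α : Type*} {a : α} {x y u z : List α} (h : a ∉ x)
    (e : x ++ y = u ++ a :: z) : ∃ u', u = x ++ u' ∧ y = u' ++ a :: z := by
  rcases List.append_eq_append_iff.1 e with ⟨u', rfl, rfl⟩ | ⟨u', rfl, e'⟩
  · exact ⟨u', rfl, rfl⟩
  · cases u' with
    | nil => exact ⟨[], by simp, by simpa using e'.symm⟩
    | cons b u' =>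
      obtain ⟨rfl, _⟩ := List.cons.inj e'
      simp at h

theorem append_cons_inj {α : Type*} {a : α} {x y x' y' : List α} (h : a ∉ x) (h' : a ∉ x')
    (e : x ++ a :: y = x' ++ a :: y') : x = x' ∧ y = y' := by
  obtain ⟨u, rfl, e'⟩ := append_eq_append_cons_of_notMem h e
  cases u with
  | nil => simpa using e'
  | cons b u =>
    obtain ⟨rfl, _⟩ := List.cons.inj e'
    simp at h'

/-- Only gadgets match the pattern of a gadget. -/
theorem exists_of_flatMap_gadget_eq {vs : List (List ℕ)} {u u' α β : List Sym}
    (hα : ∀ c ∈ α, c ≤ 3) (hβ : ∀ c ∈ β, c ≤ 3)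
    (h : vs.flatMap (gadget wt n k) = u ++ 4 :: α ++ 5 :: β ++ 6 :: u') :
    ∃ v ∈ vs, α = vec wt n k v ∧ β = vec wt n k v := by
  have no : ∀ {x : List Sym}, (∀ c ∈ x, c ≤ 3) → ∀ c : Sym, 3 < c → c ∉ x :=
    fun hx c hc h => absurd (hx c h) (not_le.2 hc)
  induction vs generalizing u with
  | nil => simp at h
  | cons v vs ih =>
    have hv := fun c => no (fun c => le_of_mem_vec (wt := wt) (n := n) (k := k) (v := v) (c := c)) c
    simp only [List.flatMap_cons, gadget, List.append_assoc, List.cons_append,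
      List.nil_append] at h
    cases u with
    | nil =>
      simp only [List.nil_append, List.cons.injEq, true_and] at h
      obtain ⟨h₁, h⟩ := append_cons_inj (hv 5 (by decide)) (no hα 5 (by decide)) h
      obtain ⟨h₂, -⟩ := append_cons_inj (hv 6 (by decide)) (no hβ 6 (by decide)) h
      exact ⟨v, by simp, h₁.symm, h₂.symm⟩
    | cons c u =>
      have h' : (vec wt n k v ++ 5 :: vec wt n k v ++ [6]) ++ vs.flatMap (gadget wt n k) =
          u ++ 4 :: (α ++ 5 :: (β ++ 6 :: u')) := by
        simp only [List.cons_append, List.cons.injEq] at h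
        simpa using h.2
      obtain ⟨u₂, rfl, h₂⟩ := append_eq_append_cons_of_notMem
        (by simpa using hv 4 (by decide)) h'
      obtain ⟨w, hw, h⟩ := ih (u := u₂) (by simpa using h₂)
      exact ⟨w, by simp [hw], h⟩

theorem joined_of_map_eq {zs : List Quad} {f g : Quad → Sym} {v w : List ℕ}
    (h : ∀ z ∈ zs, Compat (f z) (g z)) (hf : zs.map f = vec wt n k v)
    (hg : zs.map g = vec wt n k w) : Joined wt n k v w := by
  intro i hi
  have h₁ := getElem?_vec (wt := wt) (k := k) v hi
  have h₂ := getElem?_vec (wt := wt) (k := k) w hi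
  rw [← hf, List.getElem?_map, Option.map_eq_some_iff] at h₁
  rw [← hg, List.getElem?_map, Option.map_eq_some_iff] at h₂
  obtain ⟨z, hz, e₁⟩ := h₁
  obtain ⟨z', hz', e₂⟩ := h₂
  obtain rfl : z = z' := by simpa [hz] using hz'
  rw [← e₁, ← e₂]
  exact h z (List.mem_of_getElem? hz)

theorem le_of_mem_map {zs : List Quad} (h : ∀ z ∈ zs, z.Ok) {f : Quad → Sym}
    (hf : ∀ z, z.Ok → f z ≤ 2) : ∀ c ∈ zs.map f, c ≤ 3 := by
  intro c hc
  obtain ⟨z, hz, rfl⟩ := List.mem_map.1 hc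
  exact (hf z (h z hz)).trans (by decide)

/-- The six tuples that the grammar selects are joined pairwise: the inner pairs compare the tuples
`1`, `2`, `5`, `6` and `2`, `3`, `4`, `5`, the outer pair compares `1`, `3`, `4`, `6`, and any two
of the six occur together in one of these comparisons. -/
theorem exists_joined_of_mem_language (h : encode wt n k ∈ grammar.language) :
    ∃ v : Fin 6 → List ℕ, (∀ g, v g ∈ tuples n k) ∧
      ∀ g h, g < h → Joined wt n k (v g) (v h) := by
  obtain ⟨u, m, u', x, y, ⟨x₁, y₁, x₂, y₂, ⟨w₁, w₁', z₁, hz₁, rfl, rfl⟩,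
    ⟨w₂, w₂', z₂, hz₂, rfl, rfl⟩, z₃, hz₃, rfl, rfl⟩, hs⟩ := mem_language_iff.1 h
  unfold encode at hs
  have ha := fun {zs : List Quad} (h : ∀ z ∈ zs, z.Ok) => le_of_mem_map h fun z hz => hz.1.1
  have hb := fun {zs : List Quad} (h : ∀ z ∈ zs, z.Ok) => le_of_mem_map h fun z hz => hz.1.2.1
  have hc := fun {zs : List Quad} (h : ∀ z ∈ zs, z.Ok) => le_of_mem_map h fun z hz => hz.2.1.2.1
  have hd := fun {zs : List Quad} (h : ∀ z ∈ zs, z.Ok) => le_of_mem_map h fun z hz => hz.2.2.1.2.1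
  have hr : ∀ {x : List Sym}, (∀ c ∈ x, c ≤ 3) → ∀ c ∈ x.reverse, c ≤ 3 :=
    fun hx c hc => hx c (List.mem_reverse.1 hc)
  have rev : ∀ {x : List Sym} {v : List ℕ}, x.reverse = vec wt n k v → x = vec wt n k v :=
    fun h => by rw [← reverse_vec, ← h, List.reverse_reverse]
  -- The string contains the pattern of a gadget at six places.
  obtain ⟨v₁, m₁, e₁, f₁⟩ := exists_of_flatMap_gadget_eq (u := u) (α := (z₃.map Quad.a).reverse)
    (β := (z₁.map Quad.a).reverse) (hr (ha hz₃)) (hr (ha hz₁))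
    (by rw [hs]; simp only [List.append_assoc, List.cons_append, List.nil_append]; rfl)
  obtain ⟨v₂, m₂, e₂, f₂⟩ := exists_of_flatMap_gadget_eq
    (u := u ++ 4 :: (z₃.map Quad.a).reverse ++ 5 :: (z₁.map Quad.a).reverse ++ 6 :: w₁)
    (α := z₁.map Quad.b) (β := (z₂.map Quad.a).reverse) (hb hz₁) (hr (ha hz₂))
    (by rw [hs]; simp only [List.append_assoc, List.cons_append, List.nil_append]; rfl)
  obtain ⟨v₃, m₃, e₃, f₃⟩ := exists_of_flatMap_gadget_eq
    (u := u ++ 4 :: (z₃.map Quad.a).reverse ++ 5 :: (z₁.map Quad.a).reverse ++ 6 :: w₁ ++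
      4 :: z₁.map Quad.b ++ 5 :: (z₂.map Quad.a).reverse ++ 6 :: w₂)
    (α := z₂.map Quad.b) (β := z₃.map Quad.b) (hb hz₂) (hb hz₃)
    (by rw [hs]; simp only [List.append_assoc, List.cons_append, List.nil_append]; rfl)
  obtain ⟨v₄, m₄, e₄, f₄⟩ := exists_of_flatMap_gadget_eq
    (u := u ++ 4 :: (z₃.map Quad.a).reverse ++ 5 :: (z₁.map Quad.a).reverse ++ 6 :: w₁ ++
      4 :: z₁.map Quad.b ++ 5 :: (z₂.map Quad.a).reverse ++ 6 :: w₂ ++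
      4 :: z₂.map Quad.b ++ 5 :: z₃.map Quad.b ++ 6 :: m)
    (α := (z₃.map Quad.c).reverse) (β := (z₂.map Quad.c).reverse) (hr (hc hz₃)) (hr (hc hz₂))
    (by rw [hs]; simp only [List.append_assoc, List.cons_append, List.nil_append]; rfl)
  obtain ⟨v₅, m₅, e₅, f₅⟩ := exists_of_flatMap_gadget_eq
    (u := u ++ 4 :: (z₃.map Quad.a).reverse ++ 5 :: (z₁.map Quad.a).reverse ++ 6 :: w₁ ++
      4 :: z₁.map Quad.b ++ 5 :: (z₂.map Quad.a).reverse ++ 6 :: w₂ ++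
      4 :: z₂.map Quad.b ++ 5 :: z₃.map Quad.b ++ 6 :: m ++
      4 :: (z₃.map Quad.c).reverse ++ 5 :: (z₂.map Quad.c).reverse ++ 6 :: w₂')
    (α := z₂.map Quad.d) (β := (z₁.map Quad.c).reverse) (hd hz₂) (hr (hc hz₁))
    (by rw [hs]; simp only [List.append_assoc, List.cons_append, List.nil_append]; rfl)
  obtain ⟨v₆, m₆, e₆, f₆⟩ := exists_of_flatMap_gadget_eq (u' := u')
    (u := u ++ 4 :: (z₃.map Quad.a).reverse ++ 5 :: (z₁.map Quad.a).reverse ++ 6 :: w₁ ++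
      4 :: z₁.map Quad.b ++ 5 :: (z₂.map Quad.a).reverse ++ 6 :: w₂ ++
      4 :: z₂.map Quad.b ++ 5 :: z₃.map Quad.b ++ 6 :: m ++
      4 :: (z₃.map Quad.c).reverse ++ 5 :: (z₂.map Quad.c).reverse ++ 6 :: w₂' ++
      4 :: z₂.map Quad.d ++ 5 :: (z₁.map Quad.c).reverse ++ 6 :: w₁')
    (α := z₁.map Quad.d) (β := z₃.map Quad.d) (hd hz₁) (hd hz₃)
    (by rw [hs]; simp only [List.append_assoc, List.cons_append, List.nil_append])
  replace e₁ := rev e₁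
  replace f₁ := rev f₁
  replace f₂ := rev f₂
  replace e₄ := rev e₄
  replace f₄ := rev f₄
  replace f₅ := rev f₅
  have j₁₂ := joined_of_map_eq (fun z hz => (hz₁ z hz).1) f₁ e₂
  have j₁₃ := joined_of_map_eq (fun z hz => (hz₃ z hz).1) e₁ f₃
  have j₁₄ := joined_of_map_eq (fun z hz => (hz₃ z hz).2.1) e₁ e₄
  have j₁₅ := joined_of_map_eq (fun z hz => (hz₁ z hz).2.1) f₁ f₅
  have j₁₆ := joined_of_map_eq (fun z hz => (hz₁ z hz).2.2.1) f₁ e₆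
  have j₂₃ := joined_of_map_eq (fun z hz => (hz₂ z hz).1) f₂ e₃
  have j₂₄ := joined_of_map_eq (fun z hz => (hz₂ z hz).2.1) f₂ f₄
  have j₂₅ := joined_of_map_eq (fun z hz => (hz₁ z hz).2.2.2.1) e₂ f₅
  have j₂₆ := joined_of_map_eq (fun z hz => (hz₁ z hz).2.2.2.2.1) e₂ e₆
  have j₃₄ := joined_of_map_eq (fun z hz => (hz₂ z hz).2.2.2.1) e₃ f₄
  have j₃₅ := joined_of_map_eq (fun z hz => (hz₂ z hz).2.2.2.2.1) e₃ e₅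
  have j₃₆ := joined_of_map_eq (fun z hz => (hz₃ z hz).2.2.2.2.1) f₃ f₆
  have j₄₅ := joined_of_map_eq (fun z hz => (hz₂ z hz).2.2.2.2.2) f₄ e₅
  have j₄₆ := joined_of_map_eq (fun z hz => (hz₃ z hz).2.2.2.2.2) e₄ f₆
  have j₅₆ := joined_of_map_eq (fun z hz => (hz₁ z hz).2.2.2.2.2) f₅ e₆
  refine ⟨![v₁, v₂, v₃, v₄, v₅, v₆], ?_, ?_⟩
  · intro g
    fin_cases g <;> assumption
  · intro g h hgh
    fin_cases g <;> fin_cases h <;> first | assumption | exact absurd hgh (by decide)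

/-- The growth steps that compare the vectors of four tuples. -/
def quads (wt : ℕ → ℕ → ℕ) (n k : ℕ) (a b c d : List ℕ) : List Quad :=
  let half := (List.range n).map fun i => Quad.mk (symbol k (weight wt a i))
    (symbol k (weight wt b i)) (symbol k (weight wt c i)) (symbol k (weight wt d i))
  half ++ half.reverse

theorem grown_vec {a b c d : List ℕ} (hab : Joined wt n k a b) (hac : Joined wt n k a c)
    (had : Joined wt n k a d) (hbc : Joined wt n k b c) (hbd : Joined wt n k b d)
    (hcd : Joined wt n k c d) (x y : List Sym) :
    Grown x y (vec wt n k a ++ x ++ vec wt n k b) (vec wt n k c ++ y ++ vec wt n k d) := by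
  refine ⟨quads wt n k a b c d, ?_, ?_, ?_⟩
  · intro z hz
    simp only [quads, List.mem_append, List.mem_reverse, or_self, List.mem_map,
      List.mem_range] at hz
    obtain ⟨i, hi, rfl⟩ := hz
    exact ⟨hab i hi, hac i hi, had i hi, hbc i hi, hbd i hi, hcd i hi⟩
  all_goals simp [quads, vec, half, Function.comp_def]

/-- Six pairwise joined tuples that occur in this order can be selected by the grammar. -/
theorem mem_language_of_joined {v : Fin 6 → List ℕ} (hs : (List.ofFn v).Sublist (tuples n k))
    (hj : ∀ g h, g < h → Joined wt n k (v g) (v h)) : encode wt n k ∈ grammar.language := by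
  have hsplit : ∀ {v : List ℕ} {vs L : List (List ℕ)}, (v :: vs).Sublist L →
      ∃ l r, L = l ++ v :: r ∧ vs.Sublist r := by
    intro v vs L h
    obtain ⟨l, r, rfl, h₁, h₂⟩ := List.cons_sublist_iff.1 h
    obtain ⟨l₁, l₂, rfl⟩ := List.append_of_mem h₁
    exact ⟨l₁, l₂ ++ r, by simp, h₂.trans (List.sublist_append_right _ _)⟩
  simp only [List.ofFn_succ, List.ofFn_zero] at hs
  obtain ⟨l₀, _, e₀, h₁⟩ := hsplit hs
  obtain ⟨l₁, _, rfl, h₂⟩ := hsplit h₁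
  obtain ⟨l₂, _, rfl, h₃⟩ := hsplit h₂
  obtain ⟨l₃, _, rfl, h₄⟩ := hsplit h₃
  obtain ⟨l₄, _, rfl, h₅⟩ := hsplit h₄
  obtain ⟨l₅, r, rfl, -⟩ := hsplit h₅
  have hg := fun a b c d (hab : a < b) (hbc : b < c) (hcd : c < d) =>
    grown_vec (hj a b hab) (hj a c (hab.trans hbc)) (hj a d ((hab.trans hbc).trans hcd))
      (hj b c hbc) (hj b d (hbc.trans hcd)) (hj c d hcd)
  refine mem_language_iff.2 ⟨l₀.flatMap (gadget wt n k), l₃.flatMap (gadget wt n k),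
    r.flatMap (gadget wt n k), _, _, ⟨_, _, _, _,
    ⟨l₁.flatMap (gadget wt n k), l₅.flatMap (gadget wt n k), hg 0 1 4 5 (by decide) (by decide)
      (by decide) _ _⟩,
    ⟨l₂.flatMap (gadget wt n k), l₄.flatMap (gadget wt n k), hg 1 2 3 4 (by decide) (by decide)
      (by decide) _ _⟩,
    hg 0 2 3 5 (by decide) (by decide) (by decide) _ _⟩, ?_⟩
  rw [encode, e₀]
  simp only [List.flatMap_append, List.flatMap_cons, gadget, List.append_assoc, List.cons_append,
    List.nil_append]
  rfl

end CliqueTAG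

/-! ### Cliques and joined tuples -/

namespace CliqueTAG

/-- The weights for a graph: the adjacency matrix with `k + 1` on the diagonal. -/
noncomputable def graphWeight (k : ℕ) (G : RAM.Graph) (x y : ℕ) : ℕ :=
  if x = y then k + 1 else RAM.graphInput.mem G (x * G.1 + y)

theorem graphInput_mem_le_one (G : RAM.Graph) (a : ℕ) : RAM.graphInput.mem G a ≤ 1 := by
  simp only [RAM.graphInput]
  split_ifs <;> omega

theorem graphInput_mem_eq_zero (G : RAM.Graph) {a : ℕ} (h : G.1 * G.1 ≤ a) :
    RAM.graphInput.mem G a = 0 := by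
  simp only [RAM.graphInput, ite_eq_right_iff, one_ne_zero, imp_false, not_exists, not_and]
  rintro u v rfl
  have hu := Nat.mul_le_mul_right G.1 (Nat.succ_le_of_lt u.2)
  have hv := v.2
  rw [Nat.succ_mul] at hu
  omega

theorem mul_add_inj {n x y x' y' : ℕ} (hy : y < n) (hy' : y' < n)
    (h : x * n + y = x' * n + y') : x = x' ∧ y = y' := by
  have hn : 0 < n := by omega
  have hx : x = x' := by
    have := congrArg (· / n) h
    simpa [mul_comm _ n, Nat.mul_add_div hn, Nat.div_eq_of_lt hy, Nat.div_eq_of_lt hy'] using this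
  subst hx
  exact ⟨rfl, by omega⟩

theorem graphInput_mem_eq_one_iff (G : RAM.Graph) (u v : Fin G.1) :
    RAM.graphInput.mem G (u * G.1 + v) = 1 ↔ G.2.Adj u v := by
  simp only [RAM.graphInput, ite_eq_left_iff, zero_ne_one, imp_false, not_not]
  constructor
  · rintro ⟨u', v', h, hadj⟩
    obtain ⟨h₁, h₂⟩ := mul_add_inj v.2 v'.2 h
    rwa [Fin.ext h₁, Fin.ext h₂]
  · exact fun h => ⟨u, v, rfl, h⟩

theorem graphWeight_self (k : ℕ) (G : RAM.Graph) (x : ℕ) : graphWeight k G x x = k + 1 := by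
  simp [graphWeight]

theorem graphWeight_le (k : ℕ) (G : RAM.Graph) (x y : ℕ) : graphWeight k G x y ≤ k + 1 := by
  unfold graphWeight
  split_ifs
  · rfl
  · have := graphInput_mem_le_one G (x * G.1 + y)
    omega

theorem graphWeight_le_one (k : ℕ) (G : RAM.Graph) {x y : ℕ} (h : x ≠ y) :
    graphWeight k G x y ≤ 1 := by
  rw [graphWeight, if_neg h]
  exact graphInput_mem_le_one G _

theorem graphWeight_eq_one_iff {k : ℕ} (hk : 1 ≤ k) (G : RAM.Graph) (u v : Fin G.1) :
    graphWeight k G u v = 1 ↔ G.2.Adj u v := by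
  unfold graphWeight
  split_ifs with h
  · rw [Fin.ext h]
    simp
    omega
  · exact graphInput_mem_eq_one_iff G u v

/-- The weights on the diagonal are too large to be balanced by zeros elsewhere. -/
theorem eq_one_of_sum_eq_card {ι : Type*} {s : Finset ι} {f : ι → ℕ}
    (h : ∀ j ∈ s, f j ≤ 1 ∨ s.card < f j) (hs : ∑ j ∈ s, f j = s.card) : ∀ j ∈ s, f j = 1 := by
  have h1 : ∀ j ∈ s, f j ≤ 1 := by
    intro j hj
    have := Finset.single_le_sum (f := f) (fun _ _ => Nat.zero_le _) hj
    rcases h j hj with h | h <;> omega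
  exact (Finset.sum_eq_sum_iff_of_le h1).1 (by simpa using hs)

theorem exists_eq_ofFn {n k : ℕ} {v : List ℕ} (h : v ∈ tuples n k) :
    ∃ f : Fin k → Fin n, v = List.ofFn fun j => (f j : ℕ) := by
  obtain ⟨rfl, hv⟩ := mem_tuples.1 h
  exact ⟨fun j => ⟨v[j], hv _ (by simp)⟩, List.ofFn_getElem.symm⟩

theorem weight_ofFn (wt : ℕ → ℕ → ℕ) {n k : ℕ} (f : Fin k → Fin n) (i : ℕ) :
    weight wt (List.ofFn fun j => (f j : ℕ)) i = ∑ j, wt (f j) i := by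
  simp [weight, List.map_ofFn, List.sum_ofFn]

variable {k : ℕ} {G : RAM.Graph}

/-- Weight `k` means: adjacent to all entries. -/
theorem adj_of_sum_eq (hk : 1 ≤ k) {f : Fin k → Fin G.1} {i : Fin G.1}
    (h : ∑ j, graphWeight k G (f j) i = k) (j : Fin k) : G.2.Adj (f j) i := by
  refine (graphWeight_eq_one_iff hk G _ _).1
    (eq_one_of_sum_eq_card (s := Finset.univ) (fun j _ => ?_) (by simpa using h) j (by simp))
  by_cases e : (f j : ℕ) = i
  · right
    simp [e, graphWeight_self]
  · exact Or.inl (graphWeight_le_one k G e)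

/-- Weight `2 * k` at an entry means: adjacent to all other entries. -/
theorem adj_of_sum_eq_two_mul (hk : 1 ≤ k) {f : Fin k → Fin G.1} {j₀ : Fin k}
    (h : ∑ j, graphWeight k G (f j) (f j₀) = 2 * k) {j : Fin k} (hj : j ≠ j₀) :
    G.2.Adj (f j) (f j₀) := by
  rw [← Finset.add_sum_erase _ _ (Finset.mem_univ j₀), graphWeight_self] at h
  have hc : (Finset.univ.erase j₀).card = k - 1 := by simp
  refine (graphWeight_eq_one_iff hk G _ _).1
    (eq_one_of_sum_eq_card (s := Finset.univ.erase j₀)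
      (f := fun j => graphWeight k G (f j) (f j₀)) (fun j _ => ?_) (by omega) j (by simp [hj]))
  by_cases e : (f j : ℕ) = f j₀
  · right
    rw [e, graphWeight_self]
    omega
  · exact Or.inl (graphWeight_le_one k G e)

theorem Compat.symm {a b : Sym} (h : Compat a b) : Compat b a := ⟨h.2.1, h.1, h.2.2.2, h.2.2.1⟩

/-- Six pairwise joined tuples form a clique. An entry of a tuple has weight at least `k + 1` there,
so compatibility leaves only the symbol `2` in its own tuple, which makes it adjacent to the other
entries, and then only the symbol `1` in the other tuples. -/
theorem mem_cliqueProblem_of_joined (hk : 1 ≤ k) {v : Fin 6 → List ℕ}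
    (hv : ∀ g, v g ∈ tuples G.1 k)
    (hj : ∀ g h, g < h → Joined (graphWeight k G) G.1 k (v g) (v h)) :
    G ∈ RAM.cliqueProblem (6 * k) := by
  choose f hf using fun g => exists_eq_ofFn (hv g)
  have hj' : ∀ g h, g ≠ h → ∀ i : Fin G.1,
      Compat (symbol k (∑ j, graphWeight k G (f g j) i))
        (symbol k (∑ j, graphWeight k G (f h j) i)) := by
    intro g h hgh i
    rw [← weight_ofFn, ← weight_ofFn, ← hf, ← hf]
    rcases lt_or_gt_of_ne hgh with hlt | hlt
    exacts [hj g h hlt i i.2, (hj h g hlt i i.2).symm]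
  have two : ∀ g j₀, ∑ j, graphWeight k G (f g j) (f g j₀) = 2 * k := by
    intro g j₀
    obtain ⟨h, hgh⟩ := exists_ne g
    have hle := (hj' g h hgh.symm (f g j₀)).1
    have hge : k + 1 ≤ ∑ j, graphWeight k G (f g j) (f g j₀) := by
      rw [← graphWeight_self k G (f g j₀)]
      exact Finset.single_le_sum (f := fun j => graphWeight k G (f g j) (f g j₀))
        (fun _ _ => Nat.zero_le _) (Finset.mem_univ j₀)
    unfold symbol at hle
    split_ifs at hle
    · omega
    · omega
    · assumption
    · exact absurd hle (by decide)
  have adj : ∀ p q : Fin 6 × Fin k, p ≠ q → G.2.Adj (f p.1 p.2) (f q.1 q.2) := by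
    rintro ⟨g, j⟩ ⟨h, j'⟩ hne
    by_cases e : g = h
    · subst e
      exact adj_of_sum_eq_two_mul hk (two g j') (by rintro rfl; exact hne rfl)
    · refine adj_of_sum_eq hk (f := f g) (i := f h j') ?_ j
      exact symbol_eq_one_iff.1
        ((hj' g h e (f h j')).2.2.2 ((symbol_eq_two_iff hk).2 (two h j')))
  have inj : Function.Injective fun p : Fin 6 × Fin k => f p.1 p.2 := by
    intro p q e
    by_contra hne
    exact (adj p q hne).ne e
  refine ⟨Finset.univ.map ⟨_, inj⟩, ?_, by simp⟩
  intro a ha b hb hab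
  simp only [Finset.coe_map, Function.Embedding.coeFn_mk, Finset.coe_univ, Set.image_univ,
    Set.mem_range] at ha hb
  obtain ⟨p, rfl⟩ := ha
  obtain ⟨q, rfl⟩ := hb
  exact adj p q (by rintro rfl; exact hab rfl)

theorem sublist_flatMap {α β : Type*} {L ds : List α} {vs : List β} {f : α → List β}
    (hd : ds.Sublist L) (h : List.Forall₂ (fun d v => v ∈ f d) ds vs) :
    vs.Sublist (L.flatMap f) := by
  refine List.Sublist.trans ?_ (hd.flatMap f)
  induction h with
  | nil => simp
  | cons h _ ih =>
    exact (List.singleton_sublist.2 h).append (ih ((List.sublist_cons_self _ _).trans hd))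

/-- A clique, listed in increasing order and cut into six tuples of length `k`, gives pairwise
joined tuples whose gadgets appear in this order in the string. -/
theorem exists_joined_of_mem_cliqueProblem (hk : 1 ≤ k) (hG : G ∈ RAM.cliqueProblem (6 * k)) :
    ∃ v : Fin 6 → List ℕ, (List.ofFn v).Sublist (tuples G.1 k) ∧
      ∀ g h, g < h → Joined (graphWeight k G) G.1 k (v g) (v h) := by
  obtain ⟨S, hS, hc⟩ := hG
  let e := S.orderEmbOfFin hc
  let f : Fin 6 → Fin k → Fin G.1 := fun g j => e (finProdFinEquiv (g, j))
  have adj : ∀ g h j j', (g, j) ≠ (h, j') → G.2.Adj (f g j) (f h j') := by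
    intro g h j j' hne
    exact hS (S.orderEmbOfFin_mem hc _) (S.orderEmbOfFin_mem hc _)
      fun he => hne (finProdFinEquiv.injective (e.injective he))
  refine ⟨fun g => List.ofFn fun j => (f g j : ℕ), ?_, ?_⟩
  · obtain ⟨k, rfl⟩ := Nat.exists_eq_succ_of_ne_zero (by omega : k ≠ 0)
    refine sublist_flatMap (ds := List.ofFn fun g => (f g 0 : ℕ)) ?_ ?_
    · have hlt : (List.ofFn fun g => (f g 0 : ℕ)).Pairwise (· < ·) := by
        refine List.pairwise_ofFn.2 fun g h hgh => ?_
        refine e.strictMono (Fin.lt_def.2 ?_)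
        simp only [finProdFinEquiv_apply_val]
        exact Nat.add_lt_add_left (Nat.mul_lt_mul_of_pos_left hgh (by omega)) _
      refine List.sublist_of_subperm_of_pairwise (r := (· < ·)) ?_ hlt List.pairwise_lt_range
      refine List.subperm_of_subset (hlt.imp fun h => h.ne) fun d hd => ?_
      obtain ⟨g, rfl⟩ := List.mem_ofFn.1 hd
      exact List.mem_range.2 (f g 0).2
    · rw [List.ofFn_eq_map, List.ofFn_eq_map, List.forall₂_map_left_iff,
        List.forall₂_map_right_iff, List.forall₂_same]
      intro g _
      rw [List.ofFn_succ]
      refine List.mem_map.2 ⟨_, mem_tuples.2 ⟨List.length_ofFn, fun d hd => ?_⟩, rfl⟩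
      obtain ⟨j, rfl⟩ := List.mem_ofFn.1 hd
      exact (f g j.succ).2
  · intro g h hgh i hi
    have hne : g ≠ h := hgh.ne
    simp only [weight_ofFn]
    obtain ⟨i, rfl⟩ : ∃ i' : Fin G.1, i = i' := ⟨⟨i, hi⟩, rfl⟩
    -- The symbol is at most `1` unless the vertex occurs in the tuple, where it is `2`.
    have low : ∀ g, (∀ j, f g j ≠ i) → symbol k (∑ j, graphWeight k G (f g j) i) ≤ 1 := by
      intro g hg
      have : ∑ j, graphWeight k G (f g j) i ≤ k := by
        refine (Finset.sum_le_sum fun j _ => graphWeight_le_one k G (y := i)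
          fun h => hg j (Fin.ext h)).trans ?_
        simp
      unfold symbol
      split_ifs
      · decide
      · decide
      · omega
      · omega
    have high : ∀ g j₀, symbol k (∑ j, graphWeight k G (f g j) (f g j₀)) = 2 := by
      intro g j₀
      rw [symbol_eq_two_iff hk, ← Finset.add_sum_erase _ _ (Finset.mem_univ j₀), graphWeight_self,
        Finset.sum_congr rfl (g := fun _ => 1)]
      · simp
        omega
      · intro j hj
        exact (graphWeight_eq_one_iff hk G _ _).2
          (adj g g j j₀ (by simpa using Finset.ne_of_mem_erase hj))
    have mid : ∀ g h, g ≠ h → ∀ j₀, symbol k (∑ j, graphWeight k G (f g j) (f h j₀)) = 1 := by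
      intro g h hne j₀
      rw [symbol_eq_one_iff, Finset.sum_congr rfl (g := fun _ => 1)]
      · simp
      · exact fun j _ => (graphWeight_eq_one_iff hk G _ _).2 (adj g h j j₀ (by simp [hne]))
    by_cases h₁ : ∃ j, f g j = i
    · obtain ⟨j, rfl⟩ := h₁
      rw [high, mid h g hne.symm]
      exact ⟨by decide, by decide, by decide, by decide⟩
    by_cases h₂ : ∃ j, f h j = i
    · obtain ⟨j, rfl⟩ := h₂
      rw [high, mid g h hne]
      exact ⟨by decide, by decide, by decide, by decide⟩
    have l₁ := low g (by simpa using h₁)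
    have l₂ := low h (by simpa using h₂)
    exact ⟨l₁.trans (by decide), l₂.trans (by decide),
      fun h => absurd (h ▸ l₁) (by decide), fun h => absurd (h ▸ l₂) (by decide)⟩

/-- The string of a graph is in the language if and only if the graph has a `6 * k`-clique. -/
theorem encode_mem_language_iff (hk : 1 ≤ k) (G : RAM.Graph) :
    encode (graphWeight k G) G.1 k ∈ grammar.language ↔ G ∈ RAM.cliqueProblem (6 * k) := by
  constructor
  · intro h
    obtain ⟨v, hv, hj⟩ := exists_joined_of_mem_language h
    exact mem_cliqueProblem_of_joined hk hv hj
  · intro h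
    obtain ⟨v, hv, hj⟩ := exists_joined_of_mem_cliqueProblem hk h
    exact mem_language_of_joined hv hj

end CliqueTAG

/-! ### Verification of programs for the random access machine -/

namespace RAM

namespace Program

theorem run_add (P : Program) (i j : ℕ) (c : Config) : P.run (i + j) c = P.run j (P.run i c) := by
  rw [run, run, run, Nat.add_comm, Function.iterate_add_apply]

theorem run_succ (P : Program) (j : ℕ) (c : Config) : P.run (j + 1) c = P.step (P.run j c) :=
  Function.iterate_succ_apply' _ _ _

theorem step_of_getElem? {P : Program} {c : Config} {i : Instr} (h : P[c.pc]? = some i) :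
    P.step c = i.exec c := by
  simp [step, h]

theorem Halted.run_eq {P : Program} {c : Config} (h : P.Halted c) (j : ℕ) : P.run j c = c := by
  induction j with
  | zero => rfl
  | succ j ih =>
    rw [run_succ, ih, step, List.getElem?_eq_none h]

/-- Within at most `t` steps `P` gets from `c` to `c'`, and all numbers on the way are at most
`B`. -/
def Reach (P : Program) (B t : ℕ) (c c' : Config) : Prop :=
  ∃ j ≤ t, P.run j c = c' ∧ ∀ i ≤ j, (P.run i c).BoundedBy B

theorem Reach.refl {P : Program} {B : ℕ} {c : Config} (h : c.BoundedBy B) : P.Reach B 0 c c :=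
  ⟨0, le_rfl, rfl, fun i hi => by rwa [Nat.le_zero.1 hi]⟩

theorem Reach.trans {P : Program} {B t t' : ℕ} {c c' c'' : Config} (h : P.Reach B t c c')
    (h' : P.Reach B t' c' c'') : P.Reach B (t + t') c c'' := by
  obtain ⟨j, hj, rfl, hb⟩ := h
  obtain ⟨j', hj', rfl, hb'⟩ := h'
  refine ⟨j + j', add_le_add hj hj', P.run_add j j' c, fun i hi => ?_⟩
  rcases le_total i j with hij | hij
  · exact hb i hij
  · obtain ⟨l, rfl⟩ := Nat.exists_eq_add_of_le hij
    rw [run_add]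
    exact hb' l (by omega)

theorem Reach.mono {P : Program} {B t t' : ℕ} {c c' : Config} (h : P.Reach B t c c')
    (ht : t ≤ t') : P.Reach B t' c c' := by
  obtain ⟨j, hj, h⟩ := h
  exact ⟨j, hj.trans ht, h⟩

theorem Reach.step {P : Program} {B : ℕ} {c : Config} {i : Instr} (h : P[c.pc]? = some i)
    (hc : c.BoundedBy B) (hc' : (i.exec c).BoundedBy B) : P.Reach B 1 c (i.exec c) := by
  have h1 : P.run 1 c = i.exec c := step_of_getElem? h
  refine ⟨1, le_rfl, h1, fun l hl => ?_⟩
  interval_cases l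
  · exact hc
  · rwa [h1]

theorem Reach.boundedBy {P : Program} {B t : ℕ} {c c' : Config} (h : P.Reach B t c c')
    (hc' : P.Halted c') (i : ℕ) : (P.run i c).BoundedBy B := by
  obtain ⟨j, hj, rfl, hb⟩ := h
  rcases le_total i j with hij | hij
  · exact hb i hij
  · obtain ⟨l, rfl⟩ := Nat.exists_eq_add_of_le hij
    rw [run_add, hc'.run_eq]
    exact hb j le_rfl

/-- A run of `P` is also a run of a program `W` that contains `P` from position `o` on, with its
jump targets translated by `f`. The predicate `X` describes the positions in `W` at which `P` may
be left. -/
theorem Reach.embed {W P : Program} {o : ℕ} {f : ℕ → ℕ} {X : ℕ → Prop}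
    (hf : ∀ t < P.length, f t = o + t) (hX : ∀ t, P.length ≤ t → X (f t)) (hX' : X (o + P.length))
    (hW : ∀ i (h : i < P.length), W[o + i]? = some (P[i].mapTarget f)) {B t : ℕ}
    {r m r' m' : ℕ → ℕ} {pc : ℕ} (hpc : P.length ≤ pc)
    (h : P.Reach B t ⟨0, r, m⟩ ⟨pc, r', m'⟩) :
    ∃ pc', X pc' ∧ W.Reach B t ⟨o, r, m⟩ ⟨pc', r', m'⟩ := by
  obtain ⟨j, hj, hrun, hb⟩ := h
  have hex : ∃ j, P.Halted (P.run j ⟨0, r, m⟩) := ⟨j, by rw [hrun]; exact hpc⟩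
  classical
  -- Once `P` has halted, `W` goes on with other instructions, so that only the steps up to the
  -- first halting configuration of `P` are comparable.
  obtain ⟨l, hl, hmin⟩ : ∃ l, P.Halted (P.run l ⟨0, r, m⟩) ∧
      ∀ i < l, ¬ P.Halted (P.run i ⟨0, r, m⟩) :=
    ⟨Nat.find hex, Nat.find_spec hex, fun i hi => Nat.find_min hex hi⟩
  have hlj : l ≤ j := by
    by_contra hlt
    exact hmin j (not_le.1 hlt) (by rw [hrun]; exact hpc)
  have hlast : P.run l ⟨0, r, m⟩ = ⟨pc, r', m'⟩ := by
    obtain ⟨d, rfl⟩ := Nat.exists_eq_add_of_le hlj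
    rw [run_add, hl.run_eq] at hrun
    exact hrun
  have key : ∀ i ≤ l, ∃ pc', W.run i ⟨o, r, m⟩ =
      ⟨pc', (P.run i ⟨0, r, m⟩).reg, (P.run i ⟨0, r, m⟩).mem⟩ ∧
      ((P.run i ⟨0, r, m⟩).pc < P.length → pc' = o + (P.run i ⟨0, r, m⟩).pc) ∧
      (P.length ≤ (P.run i ⟨0, r, m⟩).pc → X pc') := by
    intro i
    induction i with
    | zero =>
      intro _
      refine ⟨o, rfl, fun _ => rfl, fun h => ?_⟩
      have : P.length = 0 := Nat.le_zero.1 h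
      simpa [this] using hX'
    | succ i ih =>
      intro hi
      obtain ⟨pc', h₁, h₂, -⟩ := ih (by omega)
      have hlt : (P.run i ⟨0, r, m⟩).pc < P.length := not_le.1 (hmin i (by omega))
      obtain rfl := h₂ hlt
      rw [run_succ, run_succ, h₁]
      generalize P.run i ⟨0, r, m⟩ = c at hlt
      rw [step_of_getElem? (hW c.pc hlt), step_of_getElem? (List.getElem?_eq_getElem hlt)]
      have next : c.pc + 1 < P.length → o + c.pc + 1 = o + (c.pc + 1) := fun _ => by omega
      have next' : P.length ≤ c.pc + 1 → X (o + c.pc + 1) := fun h => by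
        have : o + c.pc + 1 = o + P.length := by omega
        rwa [this]
      cases P[c.pc] with
      | const d v => exact ⟨_, rfl, next, next'⟩
      | op o' d a b => exact ⟨_, rfl, next, next'⟩
      | load d a => exact ⟨_, rfl, next, next'⟩
      | store a b => exact ⟨_, rfl, next, next'⟩
      | jumpLt a b t =>
        refine ⟨_, rfl, ?_, ?_⟩ <;> simp only [Instr.exec] <;> split_ifs
        exacts [hf t, next, hX t, next']
      | jumpEq a b t =>
        refine ⟨_, rfl, ?_, ?_⟩ <;> simp only [Instr.exec] <;> split_ifs
        exacts [hf t, next, hX t, next']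
  obtain ⟨pc', h₁, -, h₃⟩ := key l le_rfl
  refine ⟨pc', h₃ hl, l, hlj.trans hj, by rw [h₁, hlast], fun i hi => ?_⟩
  obtain ⟨_, h₁, -, -⟩ := key i hi
  have := hb i (hi.trans hlj)
  rw [h₁]
  exact this

/-- Total correctness: started with the registers `r` and the memory `m`, the program `P` halts
after at most `t` steps, with registers and memory that satisfy `post`, and all numbers that occur
are at most `B`. -/
def WP (P : Program) (B t : ℕ) (post : (ℕ → ℕ) → (ℕ → ℕ) → Prop) (r m : ℕ → ℕ) : Prop :=
  ∃ r' m' pc, P.length ≤ pc ∧ P.Reach B t ⟨0, r, m⟩ ⟨pc, r', m'⟩ ∧ post r' m'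

variable {P Q : Program} {B t t' : ℕ} {post post' : (ℕ → ℕ) → (ℕ → ℕ) → Prop} {r m : ℕ → ℕ}

theorem WP.mono (h : P.WP B t post r m) (hp : ∀ r m, post r m → post' r m) (ht : t ≤ t') :
    P.WP B t' post' r m := by
  obtain ⟨r', m', pc, hpc, hr, hq⟩ := h
  exact ⟨r', m', pc, hpc, hr.mono ht, hp _ _ hq⟩

theorem WP.mono_bound {B' : ℕ} (h : P.WP B t post r m) (hB : B ≤ B') : P.WP B' t post r m := by
  obtain ⟨r', m', pc, hpc, ⟨j, hj, hr, hb⟩, hq⟩ := h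
  exact ⟨r', m', pc, hpc, ⟨j, hj, hr, fun i hi =>
    ⟨fun a => ((hb i hi).1 a).trans hB, fun a => ((hb i hi).2 a).trans hB⟩⟩, hq⟩

theorem WP.andThen (h : P.WP B t (Q.WP B t' post) r m) :
    (P.andThen Q).WP B (t + t') post r m := by
  obtain ⟨r₁, m₁, pc, hpc, hr, r₂, m₂, pc', hpc', hr', hq⟩ := h
  obtain ⟨_, rfl, h₁⟩ := hr.embed (W := P.andThen Q) (o := 0) (f := fun t => min t P.length)
    (X := fun pc => pc = P.length) (fun t ht => by simp [ht.le]) (fun t ht => by simp [ht])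
    (by simp) (fun i hi => by simp [Program.andThen, hi, List.getElem?_append]) hpc
  obtain ⟨pc'', h, h₂⟩ := hr'.embed (W := P.andThen Q) (o := P.length)
    (f := fun t => P.length + t) (X := fun pc => P.length + Q.length ≤ pc)
    (fun t _ => rfl) (fun t ht => by omega) le_rfl
    (fun i hi => by simp [Program.andThen, hi]) hpc'
  exact ⟨r₂, m₂, pc'', by simpa [Program.andThen] using h, h₁.trans h₂, hq⟩

theorem WP.nil (hb : (Config.mk 0 r m).BoundedBy B) (h : post r m) :
    WP [] B 0 post r m :=
  ⟨r, m, 0, le_rfl, .refl hb, h⟩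

/-- The programs of the list, one after the other. -/
def seq (Ps : List Program) : Program := Ps.foldr andThen []

theorem WP.seq_cons {Ps : List Program} (h : P.WP B t ((seq Ps).WP B t' post) r m) :
    (seq (P :: Ps)).WP B (t + t') post r m := h.andThen

/-- Skip `P` if register `a` is less than register `b`. -/
def skipLt (a b : ℕ) (P : Program) : Program :=
  Instr.jumpLt a b (P.length + 1) :: P.map (Instr.mapTarget fun t => 1 + min t P.length)

/-- Repeat `P` as long as the registers `a` and `b` are different. -/
def whileNe (a b : ℕ) (P : Program) : Program :=
  Instr.jumpEq a b (P.length + 2) ::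
    (P.map (Instr.mapTarget fun t => 1 + min t P.length) ++ [Instr.jumpEq a a 0])

theorem WP.skipLt {a b : ℕ} (hb : (Config.mk 0 r m).BoundedBy B) (h : r a < r b → post r m)
    (h' : r b ≤ r a → P.WP B t post r m) : (skipLt a b P).WP B (t + 1) post r m := by
  have hs := Reach.step (P := Program.skipLt a b P) (c := ⟨0, r, m⟩) (B := B)
    (i := Instr.jumpLt a b (P.length + 1)) rfl hb hb
  by_cases hab : r a < r b
  · refine ⟨r, m, P.length + 1, by simp [Program.skipLt], ?_, h hab⟩
    simp only [Instr.exec, if_pos hab] at hs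
    exact hs.mono (by omega)
  · simp only [Instr.exec, if_neg hab] at hs
    obtain ⟨r', m', pc, hpc, hr, hq⟩ := h' (not_lt.1 hab)
    obtain ⟨_, rfl, h₁⟩ := hr.embed (W := Program.skipLt a b P) (o := 1)
      (f := fun t => 1 + min t P.length) (X := fun pc => pc = 1 + P.length)
      (fun t ht => by simp [ht.le]) (fun t ht => by simp [ht]) rfl
      (fun i hi => by simp [Program.skipLt, Nat.add_comm 1 i, hi]) hpc
    exact ⟨r', m', _, by simp [Program.skipLt, Nat.add_comm], (hs.trans h₁).mono (by omega), hq⟩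

/-- A loop with `N` rounds, by means of an invariant that is indexed by the number of rounds so
far. -/
theorem WP.whileNe {a b : ℕ} (N : ℕ) (Inv : ℕ → (ℕ → ℕ) → (ℕ → ℕ) → Prop)
    (hb : ∀ i r m, Inv i r m → (Config.mk 0 r m).BoundedBy B) (h0 : Inv 0 r m)
    (hs : ∀ i < N, ∀ r m, Inv i r m → r a ≠ r b ∧ P.WP B t (Inv (i + 1)) r m)
    (hN : ∀ r m, Inv N r m → r a = r b ∧ post r m) :
    (whileNe a b P).WP B (N * (t + 2) + 1) post r m := by
  have key : ∀ l ≤ N, ∀ r m, Inv (N - l) r m → ∃ r' m',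
      (Program.whileNe a b P).Reach B (l * (t + 2) + 1) ⟨0, r, m⟩ ⟨P.length + 2, r', m'⟩ ∧
        post r' m' := by
    intro l
    induction l with
    | zero =>
      intro _ r m hi
      obtain ⟨hab, hq⟩ := hN r m hi
      have hs := Reach.step (P := Program.whileNe a b P) (c := ⟨0, r, m⟩) (B := B)
        (i := Instr.jumpEq a b (P.length + 2)) rfl (hb _ _ _ hi) (hb _ _ _ hi)
      simp only [Instr.exec, if_pos hab] at hs
      exact ⟨r, m, hs.mono (by omega), hq⟩
    | succ l ih =>
      intro hl r m hi
      obtain ⟨hab, r₁, m₁, pc, hpc, hr, hi'⟩ := hs (N - (l + 1)) (by omega) r m hi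
      have hs₁ := Reach.step (P := Program.whileNe a b P) (c := ⟨0, r, m⟩) (B := B)
        (i := Instr.jumpEq a b (P.length + 2)) rfl (hb _ _ _ hi) (hb _ _ _ hi)
      simp only [Instr.exec, if_neg hab] at hs₁
      obtain ⟨_, rfl, hs₂⟩ := hr.embed (W := Program.whileNe a b P) (o := 1)
        (f := fun t => 1 + min t P.length) (X := fun pc => pc = 1 + P.length)
        (fun t ht => by simp [ht.le]) (fun t ht => by simp [ht]) rfl
        (fun i hi => by simp [Program.whileNe, Nat.add_comm 1 i, hi, List.getElem?_append]) hpc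
      have hs₃ := Reach.step (P := Program.whileNe a b P) (c := ⟨1 + P.length, r₁, m₁⟩) (B := B)
        (i := Instr.jumpEq a a 0)
        (by simp [Program.whileNe, Nat.add_comm 1]) (hb _ _ _ hi') (hb _ _ _ hi')
      simp only [Instr.exec, if_true] at hs₃
      rw [show N - (l + 1) + 1 = N - l by omega] at hi'
      obtain ⟨r', m', hs₄, hq⟩ := ih (by omega) r₁ m₁ hi'
      exact ⟨r', m', (((hs₁.trans hs₂).trans hs₃).trans hs₄).mono (by ring_nf; omega), hq⟩
  obtain ⟨r', m', hr, hq⟩ := key N le_rfl r m (by simpa using h0)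
  exact ⟨r', m', _, by simp [Program.whileNe], hr, hq⟩

theorem IsAdditive.map (hP : P.IsAdditive) (f : ℕ → ℕ) :
    IsAdditive (P.map (Instr.mapTarget f)) := by
  intro i hi
  obtain ⟨i, hi', rfl⟩ := List.mem_map.1 hi
  have := hP i hi'
  cases i <;> exact this

theorem IsAdditive.andThen (hP : P.IsAdditive) (hQ : Q.IsAdditive) :
    (P.andThen Q).IsAdditive := by
  intro i hi
  rcases List.mem_append.1 hi with hi | hi
  exacts [hP.map _ i hi, hQ.map _ i hi]

theorem isAdditive_nil : IsAdditive [] := by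
  simp [IsAdditive]

theorem isAdditive_seq {Ps : List Program} (h : ∀ P ∈ Ps, P.IsAdditive) : (seq Ps).IsAdditive := by
  induction Ps with
  | nil => exact isAdditive_nil
  | cons P Ps ih => exact (h P (by simp)).andThen (ih fun P hP => h P (by simp [hP]))

theorem IsAdditive.skipLt (hP : P.IsAdditive) (a b : ℕ) : (skipLt a b P).IsAdditive := by
  intro i hi
  rcases List.mem_cons.1 hi with rfl | hi
  exacts [trivial, hP.map _ i hi]

theorem IsAdditive.whileNe (hP : P.IsAdditive) (a b : ℕ) : (whileNe a b P).IsAdditive := by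
  intro i hi
  rcases List.mem_cons.1 hi with rfl | hi
  · trivial
  · rcases List.mem_append.1 hi with hi | hi
    · exact hP.map _ i hi
    · rw [List.mem_singleton.1 hi]
      trivial

end Program

end RAM

namespace RAM

namespace Program

/-- Put the constant `v` into register `d`. -/
def set (d v : ℕ) : Program := [.const d v]

/-- Put the sum of the registers `a` and `b` into register `d`. -/
def add (d a b : ℕ) : Program := [.op .add d a b]

/-- Put the truncated difference of the registers `a` and `b` into register `d`. -/
def sub (d a b : ℕ) : Program := [.op .sub d a b]

/-- Load register `d` from the address in register `a`. -/
def load (d a : ℕ) : Program := [.load d a]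

/-- Store register `b` at the address in register `a`. -/
def store (a b : ℕ) : Program := [.store a b]

theorem isAdditive_set (d v : ℕ) : (set d v).IsAdditive := by
  simp [set, IsAdditive, Instr.IsAdditive]

theorem isAdditive_add (d a b : ℕ) : (add d a b).IsAdditive := by
  simp [add, IsAdditive, Instr.IsAdditive]

theorem isAdditive_sub (d a b : ℕ) : (sub d a b).IsAdditive := by
  simp [sub, IsAdditive, Instr.IsAdditive]

theorem isAdditive_load (d a : ℕ) : (load d a).IsAdditive := by
  simp [load, IsAdditive, Instr.IsAdditive]

theorem isAdditive_store (a b : ℕ) : (store a b).IsAdditive := by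
  simp [store, IsAdditive, Instr.IsAdditive]

/-- All registers and memory cells are at most `B`. -/
def Bdd (B : ℕ) (r m : ℕ → ℕ) : Prop := (∀ i, r i ≤ B) ∧ ∀ a, m a ≤ B

theorem Bdd.reg {B : ℕ} {r m : ℕ → ℕ} (h : Bdd B r m) (d : ℕ) {v : ℕ} (hv : v ≤ B) :
    Bdd B (Function.update r d v) m := by
  refine ⟨fun i => ?_, h.2⟩
  rw [Function.update_apply]
  split_ifs
  exacts [hv, h.1 i]

theorem Bdd.mem {B : ℕ} {r m : ℕ → ℕ} (h : Bdd B r m) (a : ℕ) {v : ℕ} (hv : v ≤ B) :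
    Bdd B r (Function.update m a v) := by
  refine ⟨h.1, fun i => ?_⟩
  rw [Function.update_apply]
  split_ifs
  exacts [hv, h.2 i]

variable {Ps : List Program} {P Q : Program} {B t t' : ℕ} {post post' : (ℕ → ℕ) → (ℕ → ℕ) → Prop}
  {r m : ℕ → ℕ} {d a b v : ℕ}

theorem WP.seq_nil (hb : Bdd B r m) (h : post r m) : (seq []).WP B t post r m :=
  (WP.nil hb h).mono (fun _ _ h => h) (Nat.zero_le t)

theorem WP.single {i : Instr} {r' m' : ℕ → ℕ} (he : i.exec ⟨0, r, m⟩ = ⟨1, r', m'⟩)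
    (hb : Bdd B r m) (hb' : Bdd B r' m') (h : post r' m') : WP [i] B 1 post r m := by
  have := Reach.step (P := [i]) (c := ⟨0, r, m⟩) rfl hb (by rw [he]; exact hb')
  rw [he] at this
  exact ⟨r', m', 1, le_rfl, this, h⟩

theorem WP.set (hb : Bdd B r m) (hv : v ≤ B)
    (h : Bdd B (Function.update r d v) m → (seq Ps).WP B t post (Function.update r d v) m) :
    (seq (set d v :: Ps)).WP B (t + 1) post r m := by
  have hb' := hb.reg d hv
  rw [Nat.add_comm]
  exact WP.seq_cons (WP.single rfl hb hb' (h hb'))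

theorem WP.add (hb : Bdd B r m) (hv : r a + r b ≤ B)
    (h : Bdd B (Function.update r d (r a + r b)) m →
      (seq Ps).WP B t post (Function.update r d (r a + r b)) m) :
    (seq (add d a b :: Ps)).WP B (t + 1) post r m := by
  have hb' := hb.reg d hv
  rw [Nat.add_comm]
  exact WP.seq_cons (WP.single rfl hb hb' (h hb'))

theorem WP.sub (hb : Bdd B r m)
    (h : Bdd B (Function.update r d (r a - r b)) m →
      (seq Ps).WP B t post (Function.update r d (r a - r b)) m) :
    (seq (sub d a b :: Ps)).WP B (t + 1) post r m := by
  have hb' := hb.reg d ((Nat.sub_le _ (r b)).trans (hb.1 a))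
  rw [Nat.add_comm]
  exact WP.seq_cons (WP.single rfl hb hb' (h hb'))

theorem WP.load (hb : Bdd B r m)
    (h : Bdd B (Function.update r d (m (r a))) m →
      (seq Ps).WP B t post (Function.update r d (m (r a))) m) :
    (seq (load d a :: Ps)).WP B (t + 1) post r m := by
  have hb' := hb.reg d (hb.2 (r a))
  rw [Nat.add_comm]
  exact WP.seq_cons (WP.single rfl hb hb' (h hb'))

theorem WP.store (hb : Bdd B r m)
    (h : Bdd B r (Function.update m (r a) (r b)) →
      (seq Ps).WP B t post r (Function.update m (r a) (r b))) :
    (seq (store a b :: Ps)).WP B (t + 1) post r m := by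
  have hb' := hb.mem (r a) (hb.1 b)
  rw [Nat.add_comm]
  exact WP.seq_cons (WP.single rfl hb hb' (h hb'))

theorem WP.skipLt_set (hb : Bdd B r m) (hv : v ≤ B)
    (h : Bdd B (Function.update r d (if r a < r b then r d else v)) m →
      (seq Ps).WP B t post (Function.update r d (if r a < r b then r d else v)) m) :
    (seq (Program.skipLt a b (Program.set d v) :: Ps)).WP B (t + 2) post r m := by
  have hb' := hb.reg d hv
  rw [Nat.add_comm]
  refine WP.seq_cons (WP.skipLt hb (fun hab => ?_) fun hab => ?_)
  · rw [if_pos hab, Function.update_eq_self] at h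
    exact h hb
  · rw [if_neg (not_lt.2 hab)] at h
    exact WP.single rfl hb hb' (h hb')

theorem WP.bdd (h : P.WP B t post r m) : P.WP B t (fun r m => post r m ∧ Bdd B r m) r m := by
  obtain ⟨r', m', pc, hpc, ⟨j, hj, hr, hb⟩, hq⟩ := h
  have := hb j le_rfl
  rw [hr] at this
  exact ⟨r', m', pc, hpc, ⟨j, hj, hr, hb⟩, hq, this⟩

/-- A part of a sequence whose effect is known. -/
theorem WP.part {T : ℕ} (hP : P.WP B t post r m) (ht : t + t' ≤ T)
    (h : ∀ r m, post r m → (seq Ps).WP B t' post' r m) :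
    (seq (P :: Ps)).WP B T post' r m :=
  (WP.seq_cons (hP.mono h le_rfl)).mono (fun _ _ h => h) ht

end Program

end RAM

/-! ### The reduction program: the gadgets -/

namespace CliqueTAG

open RAM RAM.Program

/-- The registers have the following roles. `0`: the number `n` of vertices; `1`, `2`: the
constants `1`, `0`; `3`, `4`: the first address of the weight matrix and the first address after
it; `5`: the length of the output so far; `6`: a vertex; `7`, `8`: auxiliary; `9`: the next
symbol; `10`, `11`, `12`, `13`: the constants `k`, `k + 1`, `2 * k`, `2 * k + 1`; `14 + j`: the
address of the row of the matrix that belongs to entry `j` of the current tuple.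

`St` says that the constants, the matrix (from address `M` on, everything behind it being `0`) and
the output `out` are as they should be. -/
structure St (n k M B : ℕ) (wt : ℕ → ℕ → ℕ) (out : List Sym) (r m : ℕ → ℕ) : Prop where
  bdd : Bdd B r m
  r0 : r 0 = n
  r1 : r 1 = 1
  r2 : r 2 = 0
  r3 : r 3 = M
  r4 : r 4 = M + n * n
  r5 : r 5 = out.length
  r10 : r 10 = k
  r11 : r 11 = k + 1
  r12 : r 12 = 2 * k
  r13 : r 13 = 2 * k + 1
  free : ∀ x, 14 + k ≤ x → r x = 0
  matrix : ∀ x < n, ∀ y < n, m (M + x * n + y) = wt x y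
  beyond : ∀ a, M + n * n ≤ a → m a = 0
  output : ∀ (a : ℕ) (s : Sym), out[a]? = some s → m a = s

/-- The registers from `14 + j` on point to the rows of the entries of `v`. -/
def Rows (n M j : ℕ) (v : List ℕ) (r : ℕ → ℕ) : Prop :=
  ∀ l d, v[l]? = some d → r (14 + j + l) = M + d * n

/-- Add the weights of the entries `j`, …, `j + c - 1` at the current vertex to register `8`. -/
def sumProg : ℕ → ℕ → Program
  | _, 0 => []
  | j, c + 1 => seq [add 7 (14 + j) 6, load 7 7, add 8 8 7, sumProg (j + 1) c]

/-- Put the symbol for the weight in register `8` into register `9`. The tests run through the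
thresholds at which the symbol changes, and each overrides the ones before. -/
def symbolProg : Program :=
  seq [set 9 0, skipLt 8 10 (set 9 1), skipLt 8 11 (set 9 3), skipLt 8 12 (set 9 2),
    skipLt 8 13 (set 9 3)]

/-- Append the symbol in register `9` to the output. -/
def emitProg : Program := seq [store 5 9, add 5 5 1]

/-- Append the symbol of the current tuple at the current vertex to the output. -/
def entryProg (k : ℕ) : Program := seq [set 8 0, sumProg 0 k, symbolProg, emitProg]

/-- Append the palindrome of the current tuple to the output, with one loop upwards and one loop
downwards over the vertices. -/
def vecProg (k : ℕ) : Program :=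
  seq [set 6 0, whileNe 6 0 (seq [entryProg k, add 6 6 1]),
    whileNe 6 2 (seq [sub 6 6 1, entryProg k])]

/-- Append the gadget of the current tuple to the output. -/
def gadgetProg (k : ℕ) : Program :=
  seq [set 9 4, emitProg, vecProg k, set 9 5, emitProg, vecProg k, set 9 6, emitProg]

/-- Append the gadgets of all tuples with `l` given entries and `j` further ones to the output. -/
def nestProg (k : ℕ) : ℕ → ℕ → Program
  | _, 0 => gadgetProg k
  | l, j + 1 => seq [add (14 + l) 3 2,
      whileNe (14 + l) 4 (seq [nestProg k (l + 1) j, add (14 + l) (14 + l) 0])]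

variable {n k M B : ℕ} {wt : ℕ → ℕ → ℕ} {out : List Sym} {r m : ℕ → ℕ}

theorem St.frame (h : St n k M B wt out r m) {r' : ℕ → ℕ} (hb : Bdd B r' m)
    (hr : ∀ x, x ≠ 6 → x ≠ 7 → x ≠ 8 → x ≠ 9 → (x < 14 ∨ 14 + k ≤ x) → r' x = r x) :
    St n k M B wt out r' m where
  bdd := hb
  r0 := by rw [hr, h.r0] <;> omega
  r1 := by rw [hr, h.r1] <;> omega
  r2 := by rw [hr, h.r2] <;> omega
  r3 := by rw [hr, h.r3] <;> omega
  r4 := by rw [hr, h.r4] <;> omega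
  r5 := by rw [hr, h.r5] <;> omega
  r10 := by rw [hr, h.r10] <;> omega
  r11 := by rw [hr, h.r11] <;> omega
  r12 := by rw [hr, h.r12] <;> omega
  r13 := by rw [hr, h.r13] <;> omega
  free x hx := by rw [hr, h.free x hx] <;> omega
  matrix := h.matrix
  beyond := h.beyond
  output := h.output

theorem wp_sumProg (hB : M + n * n ≤ B) (hw : ∀ x y, wt x y ≤ k + 1) {i : ℕ} (hi : i < n)
    (hm : ∀ x < n, ∀ y < n, m (M + x * n + y) = wt x y) {v : List ℕ} (hv : ∀ d ∈ v, d < n) :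
    ∀ {j w : ℕ} {r : ℕ → ℕ}, Bdd B r m → Rows n M j v r → r 6 = i → r 8 = w →
      w + v.length * (k + 1) ≤ B →
      (sumProg j v.length).WP B (3 * v.length) (fun r' m' => m' = m ∧ Bdd B r' m ∧
        r' 8 = w + weight wt v i ∧ ∀ x, x ≠ 7 → x ≠ 8 → r' x = r x) r m := by
  induction v with
  | nil =>
    intro j w r hb _ h6 h8 _
    exact WP.nil hb ⟨rfl, hb, by simpa [weight] using h8, fun _ _ _ => rfl⟩
  | cons d v ih =>
    intro j w r hb hr h6 h8 hB'
    have hd : d < n := hv d (by simp)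
    have h14 : r (14 + j) = M + d * n := by simpa using hr 0 d (by simp)
    have hdn : (d + 1) * n ≤ n * n := Nat.mul_le_mul_right n hd
    have hwd := hw d i
    have hlen : w + wt d i + v.length * (k + 1) ≤ B := by
      rw [List.length_cons, Nat.succ_mul] at hB'
      omega
    rw [Nat.succ_mul] at hdn
    rw [List.length_cons, sumProg, show 3 * (v.length + 1) = 3 * v.length + 3 by ring]
    refine WP.add hb (by rw [h14, h6]; omega) fun hb => ?_
    rw [h14, h6] at hb ⊢
    refine WP.load hb fun hb => ?_
    rw [Function.update_self, hm d hd i hi] at hb ⊢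
    refine WP.add hb ?_ fun hb => ?_
    · simp [h8]
      omega
    · simp only [Function.update_idem, Function.update_self, ne_eq, Nat.reduceEqDiff,
        not_false_eq_true, Function.update_of_ne, h8] at hb ⊢
      refine WP.part (t' := 0) (ih (fun e he => hv e (by simp [he])) (j := j + 1) (w := w + wt d i)
        hb ?_ ?_ ?_ hlen) le_rfl ?_
      · intro l e he
        have := hr (l + 1) e (by simpa using he)
        rw [Function.update_of_ne (by omega), Function.update_of_ne (by omega), ← this]
        congr 1
        omega
      · simpa using h6
      · simp
      · rintro r' m' ⟨rfl, hb', h8', hr'⟩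
        refine WP.seq_nil hb' ⟨rfl, hb', ?_, fun x h7 h8 => ?_⟩
        · rw [h8']
          simp [weight, add_assoc]
        · rw [hr' x h7 h8, Function.update_of_ne h8, Function.update_of_ne h7]

theorem wp_symbolProg (hb : Bdd B r m) (hB : 7 ≤ B) (hk : 1 ≤ k) (h10 : r 10 = k)
    (h11 : r 11 = k + 1) (h12 : r 12 = 2 * k) (h13 : r 13 = 2 * k + 1) :
    symbolProg.WP B 9 (fun r' m' => m' = m ∧ Bdd B r' m ∧ r' 9 = symbol k (r 8) ∧
      ∀ x, x ≠ 9 → r' x = r x) r m := by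
  refine WP.set hb (by omega) fun hb => ?_
  refine WP.skipLt_set hb (by omega) fun hb => ?_
  refine WP.skipLt_set hb (by omega) fun hb => ?_
  refine WP.skipLt_set hb (by omega) fun hb => ?_
  refine WP.skipLt_set hb (by omega) fun hb => ?_
  refine WP.seq_nil hb ⟨rfl, hb, ?_, fun x hx => ?_⟩
  · simp only [Function.update_apply, Nat.reduceEqDiff, if_true, if_false, h10, h11, h12, h13]
    unfold symbol
    split_ifs <;> first | rfl | omega
  · simp only [Function.update_of_ne hx]

theorem wp_emitProg (h : St n k M B wt out r m) (hB : M ≤ B) (hM : out.length < M) {s : Sym}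
    (hs : r 9 = s) : emitProg.WP B 2 (fun r' m' => St n k M B wt (out ++ [s]) r' m' ∧
      ∀ x, x ≠ 5 → r' x = r x) r m := by
  refine WP.store h.bdd fun hb => ?_
  refine WP.add hb (by rw [h.r5, h.r1]; omega) fun hb => ?_
  have hne : ∀ x, x ≠ 5 → Function.update r 5 (r 5 + r 1) x = r x :=
    fun x hx => Function.update_of_ne hx _ _
  refine WP.seq_nil hb ⟨⟨hb, ?_, ?_, ?_, ?_, ?_, ?_, ?_, ?_, ?_, ?_, ?_, ?_, ?_, ?_⟩, hne⟩
  · rw [hne _ (by decide), h.r0]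
  · rw [hne _ (by decide), h.r1]
  · rw [hne _ (by decide), h.r2]
  · rw [hne _ (by decide), h.r3]
  · rw [hne _ (by decide), h.r4]
  · rw [Function.update_self, h.r5, h.r1]
    simp
  · rw [hne _ (by decide), h.r10]
  · rw [hne _ (by decide), h.r11]
  · rw [hne _ (by decide), h.r12]
  · rw [hne _ (by decide), h.r13]
  · exact fun x hx => by rw [hne x (by omega), h.free x hx]
  · intro x hx y hy
    rw [Function.update_of_ne (by rw [h.r5]; omega), h.matrix x hx y hy]
  · intro a ha
    rw [Function.update_of_ne (by rw [h.r5]; omega), h.beyond a ha]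
  · intro a s' ha
    rw [h.r5, hs, Function.update_apply]
    split_ifs with e
    · rw [e, List.getElem?_concat_length] at ha
      rw [Option.some_inj.1 ha]
    · obtain ⟨hlt, -⟩ := List.getElem?_eq_some_iff.1 ha
      rw [List.length_append, List.length_singleton] at hlt
      rw [List.getElem?_append_left (by omega)] at ha
      exact h.output a s' ha

/-- `B` is large enough to bound the numbers that occur: addresses, weights and constants. -/
def Enough (n k M B : ℕ) : Prop := M + n * n + 5 * n + (k + 1) * (k + 1) + 7 ≤ B

theorem wp_entryProg (h : St n k M B wt out r m) (hB : Enough n k M B) (hk : 1 ≤ k)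
    (hw : ∀ x y, wt x y ≤ k + 1) (hM : out.length < M) {v : List ℕ} (hv : v ∈ tuples n k)
    (hr : Rows n M 0 v r) {i : ℕ} (hi : i < n) (h6 : r 6 = i) :
    (entryProg k).WP B (3 * k + 12) (fun r' m' =>
      St n k M B wt (out ++ [symbol k (weight wt v i)]) r' m' ∧ r' 6 = i ∧
      ∀ x, 14 ≤ x → r' x = r x) r m := by
  obtain ⟨hlen, hv⟩ := mem_tuples.1 hv
  unfold Enough at hB
  have hkk : k * (k + 1) ≤ (k + 1) * (k + 1) := Nat.mul_le_mul_right _ (by omega)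
  refine WP.set h.bdd (by omega) fun hb => ?_
  refine WP.part (t := 3 * k) (t' := 11) (post := fun r' m' => m' = m ∧ Bdd B r' m ∧
    r' 8 = weight wt v i ∧ ∀ x, x ≠ 7 → x ≠ 8 → r' x = r x) ?_ (by omega) ?_
  · have := wp_sumProg (by omega) hw hi h.matrix hv (j := 0) (w := 0) hb
      (fun l d hd => by rw [Function.update_of_ne (by omega), hr l d hd])
      (by rw [Function.update_of_ne (by decide), h6]) (by simp) (by rw [hlen]; omega)
    rw [hlen] at this
    refine this.mono (fun r' m' h' => ⟨h'.1, h'.2.1, by simpa using h'.2.2.1, fun x h7 h8 => ?_⟩)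
      le_rfl
    rw [h'.2.2.2 x h7 h8, Function.update_of_ne h8]
  rintro r₁ m₁ ⟨rfl, hb₁, h8, hr₁⟩
  have h₁ : St n k M B wt out r₁ m₁ :=
    h.frame hb₁ fun x _ h7 h8 _ _ => hr₁ x h7 h8
  refine WP.part (t' := 2) (wp_symbolProg hb₁ (by omega) hk h₁.r10 h₁.r11 h₁.r12 h₁.r13) le_rfl ?_
  rintro r₂ m₂ ⟨rfl, hb₂, h9, hr₂⟩
  have h₂ : St n k M B wt out r₂ m₂ := h₁.frame hb₂ fun x _ _ _ h9 _ => hr₂ x h9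
  rw [h8] at h9
  refine WP.part (t' := 0) (wp_emitProg h₂ (by omega) hM h9) le_rfl ?_
  rintro r₃ m₃ ⟨h₃, hr₃⟩
  refine WP.seq_nil h₃.bdd ⟨h₃, ?_, fun x hx => ?_⟩
  · rw [hr₃ _ (by decide), hr₂ _ (by decide), hr₁ _ (by decide) (by decide), h6]
  · rw [hr₃ _ (by omega), hr₂ _ (by omega), hr₁ _ (by omega) (by omega)]

theorem Rows.congr {j : ℕ} {v : List ℕ} {r r' : ℕ → ℕ} (h : Rows n M j v r)
    (hr : ∀ x, 14 ≤ x → x < 14 + j + v.length → r' x = r x) : Rows n M j v r' := by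
  intro l d hd
  have := (List.getElem?_eq_some_iff.1 hd).1
  rw [hr _ (by omega) (by omega), h l d hd]

theorem wp_vecProg (h : St n k M B wt out r m) (hB : Enough n k M B) (hk : 1 ≤ k)
    (hw : ∀ x y, wt x y ≤ k + 1) (hM : out.length + 2 * n ≤ M) {v : List ℕ}
    (hv : v ∈ tuples n k) (hr : Rows n M 0 v r) :
    (vecProg k).WP B (n * (6 * k + 30) + 3) (fun r' m' =>
      St n k M B wt (out ++ vec wt n k v) r' m' ∧ ∀ x, 14 ≤ x → r' x = r x) r m := by
  refine WP.set h.bdd (Nat.zero_le _) fun hb => ?_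
  refine WP.part (t := n * (3 * k + 13 + 2) + 1) (t' := n * (3 * k + 15) + 1)
    (WP.whileNe (B := B) (t := 3 * k + 13) (post := fun r' m' =>
      St n k M B wt (out ++ half wt n k v) r' m' ∧ r' 6 = n ∧ ∀ x, 14 ≤ x → r' x = r x) n
    (fun i r' m' =>
      St n k M B wt (out ++ (List.range i).map fun i => symbol k (weight wt v i)) r' m' ∧
      r' 6 = i ∧ ∀ x, 14 ≤ x → r' x = r x) (fun i r' m' h => h.1.bdd) ?_ ?_ ?_)
    (by ring_nf; omega) ?_
  · refine ⟨?_, by simp, fun x hx => Function.update_of_ne (by omega) _ _⟩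
    rw [List.range_zero, List.map_nil, List.append_nil]
    exact h.frame hb fun x h6 _ _ _ _ => Function.update_of_ne h6 _ _
  · rintro i hi r₁ m₁ ⟨h₁, h6, hr₁⟩
    refine ⟨by rw [h6, h₁.r0]; omega, ?_⟩
    refine WP.part (t' := 1) (wp_entryProg h₁ hB hk hw (by simp; omega) hv
      (hr.congr fun x hx _ => hr₁ x hx) hi h6) le_rfl ?_
    rintro r₂ m₂ ⟨h₂, h6, hr₂⟩
    unfold Enough at hB
    refine WP.add h₂.bdd (by rw [h6, h₂.r1]; omega) fun hb => ?_
    refine WP.seq_nil hb ⟨?_, by rw [Function.update_self, h6, h₂.r1], fun x hx => ?_⟩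
    · rw [List.range_succ, List.map_append, ← List.append_assoc]
      exact h₂.frame hb fun x h6 _ _ _ _ => Function.update_of_ne h6 _ _
    · rw [Function.update_of_ne (by omega), hr₂ x hx, hr₁ x hx]
  · rintro r₁ m₁ ⟨h₁, h6, hr₁⟩
    exact ⟨by rw [h6, h₁.r0], h₁, h6, hr₁⟩
  rintro r₁ m₁ ⟨h₁, h6, hr₁⟩
  refine WP.part (t := n * (3 * k + 13 + 2) + 1) (t' := 0)
    (WP.whileNe (B := B) (t := 3 * k + 13) (post := fun r' m' =>
      St n k M B wt (out ++ vec wt n k v) r' m' ∧ ∀ x, 14 ≤ x → r' x = r x) n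
    (fun i r' m' => i ≤ n ∧ St n k M B wt (out ++ half wt n k v ++
      (List.range' (n - i) i).reverse.map fun i => symbol k (weight wt v i)) r' m' ∧
      r' 6 = n - i ∧ ∀ x, 14 ≤ x → r' x = r x) (fun i r' m' h => h.2.1.bdd) ?_ ?_ ?_)
    (by ring_nf; omega) (fun r' m' h => WP.seq_nil h.1.bdd h)
  · exact ⟨Nat.zero_le n, by simpa using h₁, by simpa using h6, hr₁⟩
  · rintro i hi r₂ m₂ ⟨-, h₂, h6, hr₂⟩
    refine ⟨by rw [h6, h₂.r2]; omega, ?_⟩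
    refine WP.sub h₂.bdd fun hb => ?_
    have h6' : r₂ 6 - r₂ 1 = n - (i + 1) := by
      rw [h6, h₂.r1]
      omega
    rw [h6'] at hb ⊢
    refine WP.part (t' := 0) (wp_entryProg (h₂.frame hb fun x h6 _ _ _ _ =>
      Function.update_of_ne h6 _ _) hB hk hw (by simp [half]; omega) hv
      (hr.congr fun x hx _ => ?_) (i := n - (i + 1)) (by omega) (Function.update_self _ _ _))
      (by omega) ?_
    · rw [Function.update_of_ne (by omega), hr₂ x hx]
    rintro r₃ m₃ ⟨h₃, h6, hr₃⟩
    refine WP.seq_nil h₃.bdd ⟨hi, ?_, h6, fun x hx => ?_⟩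
    · rw [List.range'_succ, show n - (i + 1) + 1 = n - i by omega, List.reverse_cons,
        List.map_append, ← List.append_assoc]
      exact h₃
    · rw [hr₃ x hx, Function.update_of_ne (by omega), hr₂ x hx]
  · rintro r₂ m₂ ⟨-, h₂, h6, hr₂⟩
    refine ⟨by rw [h6, h₂.r2]; omega, ?_, hr₂⟩
    rw [vec, ← List.append_assoc]
    rw [Nat.sub_self, ← List.range_eq_range', List.map_reverse] at h₂
    exact h₂

theorem wp_set_emitProg (h : St n k M B wt out r m) (hB : Enough n k M B)
    (hM : out.length < M) (s : Sym) {Ps : List Program} {t : ℕ}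
    {post : (ℕ → ℕ) → (ℕ → ℕ) → Prop} (hp : ∀ r' m', St n k M B wt (out ++ [s]) r' m' →
      (∀ x, 14 ≤ x → r' x = r x) → (seq Ps).WP B t post r' m') :
    (seq (set 9 s :: emitProg :: Ps)).WP B (t + 3) post r m := by
  unfold Enough at hB
  refine WP.set h.bdd (by omega) fun hb => ?_
  refine WP.part (t' := t) (wp_emitProg (h.frame hb fun x _ _ _ h9 _ =>
    Function.update_of_ne h9 _ _) (by omega) hM (Function.update_self _ _ _)) (by omega) ?_
  rintro r₁ m₁ ⟨h₁, hr₁⟩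
  refine hp r₁ m₁ h₁ fun x hx => ?_
  rw [hr₁ x (by omega), Function.update_of_ne (by omega)]

theorem wp_gadgetProg (h : St n k M B wt out r m) (hB : Enough n k M B) (hk : 1 ≤ k)
    (hw : ∀ x y, wt x y ≤ k + 1) (hM : out.length + (4 * n + 3) ≤ M) {v : List ℕ}
    (hv : v ∈ tuples n k) (hr : Rows n M 0 v r) :
    (gadgetProg k).WP B (n * (12 * k + 60) + 15) (fun r' m' =>
      St n k M B wt (out ++ gadget wt n k v) r' m' ∧ ∀ x, 14 ≤ x → r' x = r x) r m := by
  have hlen : (vec wt n k v).length = 2 * n := by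
    simp [vec, half]
    omega
  refine wp_set_emitProg h hB (by omega) 4 fun r₁ m₁ h₁ hr₁ => ?_
  refine WP.part (t' := n * (6 * k + 30) + 9) (wp_vecProg h₁ hB hk hw (by simp; omega) hv
    (hr.congr fun x hx _ => hr₁ x hx)) (by ring_nf; omega) ?_
  rintro r₂ m₂ ⟨h₂, hr₂⟩
  refine wp_set_emitProg h₂ hB (by simp [hlen]; omega) 5 fun r₃ m₃ h₃ hr₃ => ?_
  refine WP.part (t' := 3) (wp_vecProg h₃ hB hk hw (by simp [hlen]; omega) hv
    (hr.congr fun x hx _ => by rw [hr₃ x hx, hr₂ x hx, hr₁ x hx])) (by omega) ?_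
  rintro r₄ m₄ ⟨h₄, hr₄⟩
  refine wp_set_emitProg h₄ hB (by simp [hlen]; omega) 6 fun r₅ m₅ h₅ hr₅ => ?_
  refine WP.seq_nil h₅.bdd ⟨?_, fun x hx => by
    rw [hr₅ x hx, hr₄ x hx, hr₃ x hx, hr₂ x hx, hr₁ x hx]⟩
  simpa [gadget] using h₅

/-- The running time of `nestProg k l j`. -/
def nestTime (n k : ℕ) : ℕ → ℕ
  | 0 => n * (12 * k + 60) + 15
  | j + 1 => n * (nestTime n k j + 3) + 2

theorem wp_nestProg (hB : Enough n k M B) (hk : 1 ≤ k) (hw : ∀ x y, wt x y ≤ k + 1) (j : ℕ) :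
    ∀ {pre : List ℕ} {out : List Sym} {r m : ℕ → ℕ}, pre.length + j = k → (∀ d ∈ pre, d < n) →
      St n k M B wt out r m → out.length + n ^ j * (4 * n + 3) ≤ M → Rows n M 0 pre r →
      (nestProg k pre.length j).WP B (nestTime n k j) (fun r' m' =>
        St n k M B wt (out ++ (tuples n j).flatMap fun v => gadget wt n k (pre ++ v)) r' m' ∧
        ∀ x, 14 ≤ x → x < 14 + pre.length → r' x = r x) r m := by
  induction j with
  | zero =>
    intro pre out r m hl hp h hM hr
    refine (wp_gadgetProg h hB hk hw (by simpa using hM) (mem_tuples.2 ⟨hl, hp⟩) hr).mono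
      (fun r' m' h' => ⟨?_, fun x hx _ => h'.2 x hx⟩) le_rfl
    simpa [tuples] using h'.1
  | succ j ih =>
    intro pre out r m hl hp h hM hr
    have hB' := hB
    unfold Enough at hB'
    refine WP.add h.bdd (by rw [h.r3, h.r2]; omega) fun hb => ?_
    rw [h.r3, h.r2, Nat.add_zero] at hb ⊢
    refine WP.part (t' := 0) (WP.whileNe (t := nestTime n k j + 1) n
      (fun i r' m' => i ≤ n ∧ St n k M B wt (out ++ (List.range i).flatMap fun d =>
          (tuples n j).flatMap fun v => gadget wt n k (pre ++ d :: v)) r' m' ∧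
        r' (14 + pre.length) = M + i * n ∧
        ∀ x, 14 ≤ x → x < 14 + pre.length → r' x = r x) (fun i r' m' h => h.2.1.bdd) ?_ ?_ ?_)
      le_rfl (fun r' m' h => WP.seq_nil h.1.bdd h)
    · refine ⟨Nat.zero_le n, ?_, by simp, fun x _ hx => Function.update_of_ne (by omega) _ _⟩
      simpa using h.frame hb fun x _ _ _ _ hx => Function.update_of_ne (by omega) _ _
    · rintro i hi r₁ m₁ ⟨-, h₁, h14, hr₁⟩
      have hin : (i + 1) * n ≤ n * n := Nat.mul_le_mul_right n hi
      rw [Nat.succ_mul] at hin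
      refine ⟨by rw [h14, h₁.r4]; omega, ?_⟩
      have hlen : (out ++ (List.range i).flatMap fun d =>
          (tuples n j).flatMap fun v => gadget wt n k (pre ++ d :: v)).length =
          out.length + i * (n ^ j * (4 * n + 3)) := by
        simp [List.length_flatMap, length_gadget, length_tuples]
      have hM' : out.length + i * (n ^ j * (4 * n + 3)) + n ^ j * (4 * n + 3) ≤ M := by
        have h₂ : (i + 1) * (n ^ j * (4 * n + 3)) ≤ n * (n ^ j * (4 * n + 3)) :=
          Nat.mul_le_mul_right _ hi
        rw [Nat.succ_mul] at h₂
        rw [pow_succ, mul_comm (n ^ j), mul_assoc] at hM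
        omega
      have hi' := ih (pre := pre ++ [i]) (by simp; omega)
        (by
          intro d hd
          rcases List.mem_append.1 hd with hd | hd
          · exact hp d hd
          · rwa [List.mem_singleton.1 hd]) h₁ (by rw [hlen]; exact hM') (by
          intro l d hd
          by_cases hl' : l < pre.length
          · rw [List.getElem?_append_left hl'] at hd
            rw [hr₁ _ (by omega) (by omega), hr l d hd]
          · obtain ⟨hlt, hd'⟩ := List.getElem?_eq_some_iff.1 hd
            obtain rfl : l = pre.length := by
              rw [List.length_append, List.length_singleton] at hlt
              omega
            rw [List.getElem?_concat_length] at hd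
            rw [← Option.some_inj.1 hd, Nat.add_zero, h14])
      rw [List.length_append, List.length_singleton] at hi'
      refine WP.part (t' := 1) hi' le_rfl ?_
      rintro r₂ m₂ ⟨h₂, hr₂⟩
      have h14' : r₂ (14 + pre.length) = M + i * n := by
        rw [hr₂ _ (by omega) (by omega), h14]
      refine WP.add h₂.bdd (by rw [h14', h₂.r0]; omega) fun hb => ?_
      refine WP.seq_nil hb ⟨hi, ?_, ?_, fun x hx hx' => ?_⟩
      · have := h₂.frame hb fun x _ _ _ _ hx => Function.update_of_ne (by omega) _ _
        simpa [List.range_succ] using this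
      · rw [Function.update_self, h14', h₂.r0, Nat.succ_mul, Nat.add_assoc]
      · rw [Function.update_of_ne (by omega), hr₂ x hx (by omega), hr₁ x hx hx']
    · rintro r₁ m₁ ⟨-, h₁, h14, hr₁⟩
      refine ⟨by rw [h14, h₁.r4], ?_, hr₁⟩
      simpa [tuples, List.flatMap_assoc, List.flatMap_map] using h₁

end CliqueTAG

/-! ### The reduction program: the frame -/

namespace CliqueTAG

open RAM RAM.Program

/-- Multiply register `7` by `n`. -/
def mulProg : Program :=
  seq [set 8 0, set 6 0, whileNe 6 0 (seq [add 8 8 7, add 6 6 1]), add 7 8 2]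

/-- Initialize the constants. Register `3` gets the length `n ^ k * (4 * n + 3)` of the output,
which is also the address to which the adjacency matrix will be moved. -/
def setupProg (k : ℕ) : Program :=
  seq [set 1 1, set 10 k, set 11 (k + 1), set 12 (2 * k), set 13 (2 * k + 1), set 7 3, add 7 7 0,
    add 7 7 0, add 7 7 0, add 7 7 0, seq (List.replicate k mulProg), add 3 7 2, add 7 0 2, mulProg,
    add 4 3 7]

/-- Copy the adjacency matrix to the address in register `3`. The original need not be erased, since
the output will be written over it. -/
def copyProg : Program :=
  seq [add 6 3 2, whileNe 6 4 (seq [load 7 5, store 6 7, add 6 6 1, add 5 5 1]), set 5 0]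

/-- Put `k + 1` on the diagonal of the matrix; two consecutive entries of the diagonal are `n + 1`
cells apart. -/
def diagonalProg : Program :=
  seq [add 6 3 2, add 7 4 0, add 8 0 1, whileNe 6 7 (seq [store 6 11, add 6 6 8])]

/-- Erase the matrix and all registers, except for the length of the output in register `0`. -/
def cleanProg (k : ℕ) : Program :=
  seq [add 6 3 2, whileNe 6 4 (seq [store 6 2, add 6 6 1]), add 0 5 2,
    seq ((List.range (13 + k)).map fun x => set (x + 1) 0)]

/-- The reduction from `6 * k`-Clique. -/
def reduction (k : ℕ) : Program :=
  seq [setupProg k, copyProg, diagonalProg, nestProg k 0 k, cleanProg k]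

theorem isAdditive_reduction (k : ℕ) : (reduction k).IsAdditive := by
  have hmul : mulProg.IsAdditive := by
    refine isAdditive_seq ?_
    simp only [List.mem_cons, List.not_mem_nil, or_false, forall_eq_or_imp, forall_eq]
    refine ⟨isAdditive_set _ _, isAdditive_set _ _, IsAdditive.whileNe (isAdditive_seq ?_) _ _,
      isAdditive_add _ _ _⟩
    simp [isAdditive_add]
  have hentry : (entryProg k).IsAdditive := by
    have hsum : ∀ c j, (sumProg j c).IsAdditive := by
      intro c
      induction c with
      | zero => exact fun j => isAdditive_nil
      | succ c ih =>
        intro j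
        refine isAdditive_seq ?_
        simp [isAdditive_add, isAdditive_load, ih]
    refine isAdditive_seq ?_
    simp only [List.mem_cons, List.not_mem_nil, or_false, forall_eq_or_imp, forall_eq]
    refine ⟨isAdditive_set _ _, hsum _ _, isAdditive_seq ?_, isAdditive_seq ?_⟩
    · simp [isAdditive_set, IsAdditive.skipLt]
    · simp [isAdditive_add, isAdditive_store]
  have hvec : (vecProg k).IsAdditive := by
    refine isAdditive_seq ?_
    simp only [List.mem_cons, List.not_mem_nil, or_false, forall_eq_or_imp, forall_eq]
    refine ⟨isAdditive_set _ _, IsAdditive.whileNe (isAdditive_seq ?_) _ _,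
      IsAdditive.whileNe (isAdditive_seq ?_) _ _⟩
    · simp [isAdditive_add, hentry]
    · simp [isAdditive_sub, hentry]
  have hnest : ∀ j l, (nestProg k l j).IsAdditive := by
    intro j
    induction j with
    | zero =>
      intro l
      refine isAdditive_seq ?_
      have : emitProg.IsAdditive := isAdditive_seq (by simp [isAdditive_add, isAdditive_store])
      simp [isAdditive_set, hvec, this]
    | succ j ih =>
      intro l
      refine isAdditive_seq ?_
      simp only [List.mem_cons, List.not_mem_nil, or_false, forall_eq_or_imp, forall_eq]
      refine ⟨isAdditive_add _ _ _, IsAdditive.whileNe (isAdditive_seq ?_) _ _⟩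
      simp [isAdditive_add, ih]
  refine isAdditive_seq ?_
  simp only [List.mem_cons, List.not_mem_nil, or_false, forall_eq_or_imp, forall_eq]
  refine ⟨isAdditive_seq ?_, isAdditive_seq ?_, isAdditive_seq ?_, hnest k 0, isAdditive_seq ?_⟩
  · have : (seq (List.replicate k mulProg)).IsAdditive := isAdditive_seq fun P hP => by
      rwa [(List.mem_replicate.1 hP).2]
    simp [isAdditive_set, isAdditive_add, hmul, this]
  · simp only [List.mem_cons, List.not_mem_nil, or_false, forall_eq_or_imp, forall_eq]
    refine ⟨isAdditive_add _ _ _, IsAdditive.whileNe (isAdditive_seq ?_) _ _, isAdditive_set _ _⟩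
    simp [isAdditive_add, isAdditive_load, isAdditive_store]
  · simp only [List.mem_cons, List.not_mem_nil, or_false, forall_eq_or_imp, forall_eq]
    refine ⟨isAdditive_add _ _ _, isAdditive_add _ _ _, isAdditive_add _ _ _,
      IsAdditive.whileNe (isAdditive_seq ?_) _ _⟩
    simp [isAdditive_add, isAdditive_store]
  · simp only [List.mem_cons, List.not_mem_nil, or_false, forall_eq_or_imp, forall_eq]
    refine ⟨isAdditive_add _ _ _, IsAdditive.whileNe (isAdditive_seq ?_) _ _, isAdditive_add _ _ _,
      isAdditive_seq ?_⟩
    · simp [isAdditive_add, isAdditive_store]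
    · simp [isAdditive_set]

variable {n k M B : ℕ} {r m : ℕ → ℕ}

theorem wp_mulProg (hb : Bdd B r m) (h0 : r 0 = n) (h1 : r 1 = 1) (h2 : r 2 = 0) {x : ℕ}
    (h7 : r 7 = x) (hB : x * n ≤ B) :
    mulProg.WP B (n * 4 + 4) (fun r' m' => m' = m ∧ Bdd B r' m ∧ r' 7 = x * n ∧
      ∀ y, y ≠ 6 → y ≠ 7 → y ≠ 8 → r' y = r y) r m := by
  have hn : n ≤ B := h0 ▸ hb.1 0
  refine WP.set hb (Nat.zero_le _) fun hb => ?_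
  refine WP.set hb (Nat.zero_le _) fun hb => ?_
  refine WP.part (t' := 1) (WP.whileNe (t := 2) n (fun i r' m' => i ≤ n ∧ m' = m ∧ Bdd B r' m ∧
    r' 6 = i ∧ r' 8 = i * x ∧ ∀ y, y ≠ 6 → y ≠ 8 → r' y = r y)
    (post := fun r' m' => m' = m ∧ Bdd B r' m ∧ r' 8 = n * x ∧ ∀ y, y ≠ 6 → y ≠ 8 → r' y = r y)
    (fun i r' m' h => h.2.1 ▸ h.2.2.1) ?_ ?_ ?_) (by omega) ?_
  · refine ⟨Nat.zero_le n, rfl, hb, by simp, by simp, fun y h6 h8 => ?_⟩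
    rw [Function.update_of_ne h6, Function.update_of_ne h8]
  · rintro i hi r₁ m₁ ⟨-, rfl, hb, h6, h8, hr⟩
    refine ⟨by rw [h6, hr _ (by decide) (by decide), h0]; omega, ?_⟩
    have hx : (i + 1) * x ≤ n * x := Nat.mul_le_mul_right x hi
    rw [mul_comm n x] at hx
    have h7' : r₁ 7 = x := by rw [hr _ (by decide) (by decide), h7]
    refine WP.add hb (by rw [h8, h7', ← Nat.succ_mul]; exact hx.trans hB) fun hb => ?_
    refine WP.add hb ?_ fun hb => ?_
    · rw [Function.update_of_ne (by decide), Function.update_of_ne (by decide), h6,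
        hr _ (by decide) (by decide), h1]
      omega
    · refine WP.seq_nil hb ⟨hi, rfl, hb, ?_, ?_, fun y hy6 hy8 => ?_⟩
      · rw [Function.update_self, Function.update_of_ne (by decide),
          Function.update_of_ne (by decide), h6, hr _ (by decide) (by decide), h1]
      · rw [Function.update_of_ne (by decide), Function.update_self, h8, h7', Nat.succ_mul]
      · rw [Function.update_of_ne hy6, Function.update_of_ne hy8, hr y hy6 hy8]
  · rintro r₁ m₁ ⟨-, rfl, hb, h6, h8, hr⟩
    exact ⟨by rw [h6, hr _ (by decide) (by decide), h0], rfl, hb, h8, hr⟩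
  rintro r₁ m₁ ⟨rfl, hb, h8, hr⟩
  have h2' : r₁ 2 = 0 := by rw [hr _ (by decide) (by decide), h2]
  refine WP.add hb (by rw [h8, h2', mul_comm]; exact hB) fun hb => ?_
  refine WP.seq_nil hb ⟨rfl, hb, ?_, fun y h6 h7 h8 => ?_⟩
  · rw [Function.update_self, h8, h2', mul_comm, Nat.add_zero]
  · rw [Function.update_of_ne h7, hr y h6 h8]

theorem wp_replicate_mulProg (l : ℕ) : ∀ {r : ℕ → ℕ} {x : ℕ}, Bdd B r m → r 0 = n → r 1 = 1 →
    r 2 = 0 → r 7 = x → (∀ i ≤ l, x * n ^ i ≤ B) →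
    (seq (List.replicate l mulProg)).WP B (l * (n * 4 + 4)) (fun r' m' => m' = m ∧ Bdd B r' m ∧
      r' 7 = x * n ^ l ∧ ∀ y, y ≠ 6 → y ≠ 7 → y ≠ 8 → r' y = r y) r m := by
  induction l with
  | zero =>
    intro r x hb _ _ _ h7 _
    exact WP.seq_nil hb ⟨rfl, hb, by simpa using h7, fun _ _ _ _ => rfl⟩
  | succ l ih =>
    intro r x hb h0 h1 h2 h7 hB
    refine WP.part (t' := l * (n * 4 + 4)) (wp_mulProg hb h0 h1 h2 h7
      (by simpa using hB 1 (by omega))) (by rw [Nat.succ_mul]; omega) ?_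
    rintro r₁ m₁ ⟨rfl, hb, h7, hr⟩
    refine (ih hb (by rw [hr _ (by decide) (by decide) (by decide), h0])
      (by rw [hr _ (by decide) (by decide) (by decide), h1])
      (by rw [hr _ (by decide) (by decide) (by decide), h2]) h7 fun i hi => ?_).mono ?_ le_rfl
    · have := hB (i + 1) (by omega)
      rwa [pow_succ', ← mul_assoc] at this
    · rintro r₂ m₂ ⟨rfl, hb, h7, hr'⟩
      refine ⟨rfl, hb, ?_, fun y h6 h7 h8 => ?_⟩
      · rw [h7, pow_succ', mul_assoc]
      · rw [hr' y h6 h7 h8, hr y h6 h7 h8]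

/-- All that the program for the tuples needs, except for the matrix. -/
structure Ready (n k M B : ℕ) (r m : ℕ → ℕ) : Prop where
  bdd : Bdd B r m
  r0 : r 0 = n
  r1 : r 1 = 1
  r2 : r 2 = 0
  r3 : r 3 = M
  r4 : r 4 = M + n * n
  r5 : r 5 = 0
  r10 : r 10 = k
  r11 : r 11 = k + 1
  r12 : r 12 = 2 * k
  r13 : r 13 = 2 * k + 1
  free : ∀ x, 14 ≤ x → r x = 0

theorem Ready.frame (h : Ready n k M B r m) {r' m' : ℕ → ℕ} (hb : Bdd B r' m')
    (hr : ∀ x, x ≠ 6 → x ≠ 7 → x ≠ 8 → x ≠ 9 → r' x = r x) : Ready n k M B r' m' where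
  bdd := hb
  r0 := by rw [hr, h.r0] <;> omega
  r1 := by rw [hr, h.r1] <;> omega
  r2 := by rw [hr, h.r2] <;> omega
  r3 := by rw [hr, h.r3] <;> omega
  r4 := by rw [hr, h.r4] <;> omega
  r5 := by rw [hr, h.r5] <;> omega
  r10 := by rw [hr, h.r10] <;> omega
  r11 := by rw [hr, h.r11] <;> omega
  r12 := by rw [hr, h.r12] <;> omega
  r13 := by rw [hr, h.r13] <;> omega
  free x hx := by rw [hr, h.free x hx] <;> omega

theorem wp_setupProg (hr : ∀ x, x ≠ 0 → r x = 0) (h0 : r 0 = n) (hb : Bdd B r m)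
    (hB : Enough n k (n ^ k * (4 * n + 3)) B) :
    (setupProg k).WP B ((k + 1) * (n * 4 + 4) + 13) (fun r' m' => m' = m ∧
      Ready n k (n ^ k * (4 * n + 3)) B r' m) r m := by
  unfold Enough at hB
  have hkk : (k + 1) * 2 ≤ (k + 1) * (k + 1) + 1 := by nlinarith
  have hpow : ∀ i ≤ k, (4 * n + 3) * n ^ i ≤ B := by
    intro i hi
    rcases Nat.eq_zero_or_pos n with rfl | hn
    · rcases Nat.eq_zero_or_pos i with rfl | hi
      · simp
        omega
      · simp [hi.ne']
    · have := Nat.mul_le_mul_left (4 * n + 3) (Nat.pow_le_pow_right hn hi)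
      rw [mul_comm _ (n ^ k)] at this
      omega
  refine WP.set hb (by omega) fun hb => ?_
  refine WP.set hb (by omega) fun hb => ?_
  refine WP.set hb (by omega) fun hb => ?_
  refine WP.set hb (by omega) fun hb => ?_
  refine WP.set hb (by omega) fun hb => ?_
  refine WP.set hb (by omega) fun hb => ?_
  refine WP.add hb (by simp [h0]; omega) fun hb => ?_
  refine WP.add hb (by simp [h0]; omega) fun hb => ?_
  refine WP.add hb (by simp [h0]; omega) fun hb => ?_
  refine WP.add hb (by simp [h0]; omega) fun hb => ?_
  refine WP.part (t' := n * 4 + 7) (wp_replicate_mulProg (n := n) (x := 4 * n + 3) k hb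
    (by simp [h0]) (by simp) (by simp [hr]) (by simp [h0]; omega) hpow)
    (by rw [Nat.succ_mul]; omega) ?_
  rintro r₁ m₁ ⟨rfl, hb, h7, hr₁⟩
  have h0' : r₁ 0 = n := by rw [hr₁ _ (by decide) (by decide) (by decide)]; simp [h0]
  have h1' : r₁ 1 = 1 := by rw [hr₁ _ (by decide) (by decide) (by decide)]; simp
  have h2' : r₁ 2 = 0 := by rw [hr₁ _ (by decide) (by decide) (by decide)]; simp [hr]
  have h5' : r₁ 5 = 0 := by rw [hr₁ _ (by decide) (by decide) (by decide)]; simp [hr]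
  have h10 : r₁ 10 = k := by rw [hr₁ _ (by decide) (by decide) (by decide)]; simp
  have h11 : r₁ 11 = k + 1 := by rw [hr₁ _ (by decide) (by decide) (by decide)]; simp
  have h12 : r₁ 12 = 2 * k := by rw [hr₁ _ (by decide) (by decide) (by decide)]; simp
  have h13 : r₁ 13 = 2 * k + 1 := by rw [hr₁ _ (by decide) (by decide) (by decide)]; simp
  have hfree : ∀ x, 14 ≤ x → r₁ x = 0 := by
    intro x hx
    rw [hr₁ x (by omega) (by omega) (by omega)]
    simp only [Function.update_of_ne (show x ≠ 7 by omega),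
      Function.update_of_ne (show x ≠ 13 by omega), Function.update_of_ne (show x ≠ 12 by omega),
      Function.update_of_ne (show x ≠ 11 by omega), Function.update_of_ne (show x ≠ 10 by omega),
      Function.update_of_ne (show x ≠ 1 by omega), hr x (by omega)]
  rw [mul_comm] at h7
  refine WP.add hb (by rw [h7, h2']; omega) fun hb => ?_
  refine WP.add hb (by simp [h0', h2']; omega) fun hb => ?_
  refine WP.part (t' := 1) (wp_mulProg (n := n) (x := n) hb (by simp [h0']) (by simp [h1'])
    (by simp [h2']) (by simp [h0', h2']) (by omega)) (by omega) ?_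
  rintro r₂ m₂ ⟨rfl, hb, h7', hr₂⟩
  have h3 : r₂ 3 = n ^ k * (4 * n + 3) := by
    rw [hr₂ _ (by decide) (by decide) (by decide)]
    simp [h7, h2']
  refine WP.add hb (by rw [h3, h7']; omega) fun hb => WP.seq_nil hb ⟨rfl, ?_⟩
  have hf : ∀ x, x ≠ 3 → x ≠ 4 → x ≠ 6 → x ≠ 7 → x ≠ 8 →
      Function.update r₂ 4 (r₂ 3 + r₂ 7) x = r₁ x := by
    intro x h3 h4 h6 h7 h8
    rw [Function.update_of_ne h4, hr₂ x h6 h7 h8, Function.update_of_ne h7,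
      Function.update_of_ne h3]
  refine ⟨hb, ?_, ?_, ?_, ?_, ?_, ?_, ?_, ?_, ?_, ?_, fun x hx => ?_⟩
  · rw [hf _ (by decide) (by decide) (by decide) (by decide) (by decide), h0']
  · rw [hf _ (by decide) (by decide) (by decide) (by decide) (by decide), h1']
  · rw [hf _ (by decide) (by decide) (by decide) (by decide) (by decide), h2']
  · rw [Function.update_of_ne (by decide), h3]
  · rw [Function.update_self, h3, h7']
  · rw [hf _ (by decide) (by decide) (by decide) (by decide) (by decide), h5']
  · rw [hf _ (by decide) (by decide) (by decide) (by decide) (by decide), h10]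
  · rw [hf _ (by decide) (by decide) (by decide) (by decide) (by decide), h11]
  · rw [hf _ (by decide) (by decide) (by decide) (by decide) (by decide), h12]
  · rw [hf _ (by decide) (by decide) (by decide) (by decide) (by decide), h13]
  · rw [hf x (by omega) (by omega) (by omega) (by omega) (by omega), hfree x hx]

/-- As the target begins behind the matrix (`n * n ≤ M`), no cell is overwritten before it is
read. -/
theorem wp_copyProg (h : Ready n k M B r m) (hB : Enough n k M B) (hM : n * n ≤ M)
    (hm : ∀ a, n * n ≤ a → m a = 0) :
    copyProg.WP B (n * n * 6 + 3) (fun r' m' => Ready n k M B r' m' ∧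
      (∀ a < n * n, m' (M + a) = m a) ∧ ∀ a, M + n * n ≤ a → m' a = 0) r m := by
  unfold Enough at hB
  refine WP.add h.bdd (by rw [h.r3, h.r2]; omega) fun hb => ?_
  rw [h.r3, h.r2, Nat.add_zero] at hb ⊢
  refine WP.part (t' := 1) (WP.whileNe (t := 4) (n * n) (fun i r' m' => i ≤ n * n ∧ Bdd B r' m' ∧
      r' 5 = i ∧ r' 6 = M + i ∧ (∀ y, y ≠ 5 → y ≠ 6 → y ≠ 7 → r' y = r y) ∧
      (∀ a < i, m' (M + a) = m a) ∧ (∀ a < M, m' a = m a) ∧ ∀ a, M + i ≤ a → m' a = m a)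
    (post := fun r' m' => Bdd B r' m' ∧ (∀ y, y ≠ 5 → y ≠ 6 → y ≠ 7 → r' y = r y) ∧
      (∀ a < n * n, m' (M + a) = m a) ∧ ∀ a, M + n * n ≤ a → m' a = m a)
    (fun i r' m' h => h.2.1) ?_ ?_ ?_) (by omega) ?_
  · exact ⟨Nat.zero_le _, hb, by simp [h.r5], by simp,
      fun y _ h6 _ => Function.update_of_ne h6 _ _, by simp, fun _ _ => rfl, fun _ _ => rfl⟩
  · rintro i hi r₁ m₁ ⟨-, hb, h5, h6, hr, h₁, h₂, h₃⟩
    have h1' : r₁ 1 = 1 := by rw [hr _ (by decide) (by decide) (by decide), h.r1]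
    refine ⟨by rw [h6, hr _ (by decide) (by decide) (by decide), h.r4]; omega, ?_⟩
    refine WP.load hb fun hb => ?_
    rw [h5, h₂ i (by omega)] at hb ⊢
    refine WP.store hb fun hb => ?_
    rw [Function.update_of_ne (by decide), Function.update_self, h6] at hb ⊢
    refine WP.add hb (by simp [h6, h1']; omega) fun hb => ?_
    refine WP.add hb (by simp [h5, h1']; omega) fun hb => ?_
    refine WP.seq_nil hb ⟨hi, hb, by simp [h5, h1'], by simp [h6, h1', Nat.add_assoc],
      ?_, ?_, ?_, ?_⟩
    · intro y h5 h6 h7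
      rw [Function.update_of_ne h5, Function.update_of_ne h6, Function.update_of_ne h7,
        hr y h5 h6 h7]
    · intro a ha
      rcases Nat.lt_succ_iff_lt_or_eq.1 ha with ha | rfl
      · rw [Function.update_of_ne (by omega), h₁ a ha]
      · rw [Function.update_self]
    · intro a ha
      rw [Function.update_of_ne (by omega), h₂ a ha]
    · intro a ha
      rw [Function.update_of_ne (by omega), h₃ a (by omega)]
  · rintro r₁ m₁ ⟨-, hb, h5, h6, hr, h₁, h₂, h₃⟩
    exact ⟨by rw [h6, hr _ (by decide) (by decide) (by decide), h.r4], hb, hr, h₁, h₃⟩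
  rintro r₁ m₁ ⟨hb, hr, h₁, h₃⟩
  refine WP.set hb (Nat.zero_le _) fun hb => ?_
  refine WP.seq_nil hb ⟨h.frame hb fun x h6 h7 _ _ => ?_, h₁, fun a ha => ?_⟩
  · rw [Function.update_apply]
    split_ifs with h5
    · rw [h5, h.r5]
    · rw [hr x h5 h6 h7]
  · rw [h₃ a ha, hm a (by omega)]

theorem wp_diagonalProg (h : Ready n k M B r m) (hB : Enough n k M B) {A : ℕ → ℕ}
    (hm : ∀ a < n * n, m (M + a) = A a) (hm' : ∀ a, M + n * n ≤ a → m a = 0) :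
    diagonalProg.WP B (n * 4 + 4) (St n k M B
      (fun x y => if x = y then k + 1 else A (x * n + y)) []) r m := by
  unfold Enough at hB
  refine WP.add h.bdd (by rw [h.r3, h.r2]; omega) fun hb => ?_
  rw [h.r3, h.r2, Nat.add_zero] at hb ⊢
  refine WP.add hb (by simp [h.r4, h.r0]; omega) fun hb => ?_
  refine WP.add hb (by simp [h.r0, h.r1]; omega) fun hb => ?_
  have hsq : ∀ {x y : ℕ}, x < n → y < n → x * n + y < n * n := by
    intro x y hx hy
    have := Nat.mul_le_mul_right n (Nat.succ_le_of_lt hx)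
    rw [Nat.succ_mul] at this
    omega
  refine WP.part (t' := 0) (WP.whileNe (t := 2) n (fun i r' m' => i ≤ n ∧ Ready n k M B r' m' ∧
      r' 6 = M + i * (n + 1) ∧ r' 7 = M + n * n + n ∧ r' 8 = n + 1 ∧
      (∀ x < n, ∀ y < n, m' (M + x * n + y) = if x = y ∧ x < i then k + 1 else A (x * n + y)) ∧
      ∀ a, M + n * n ≤ a → m' a = 0) (fun i r' m' h => h.2.1.bdd) ?_ ?_ ?_) le_rfl
    (fun r' m' h => WP.seq_nil h.bdd h)
  · refine ⟨Nat.zero_le n, h.frame hb fun x h6 h7 h8 _ => ?_, by simp, by simp [h.r4, h.r0],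
      by simp [h.r0, h.r1], fun x hx y hy => ?_, hm'⟩
    · rw [Function.update_of_ne h8, Function.update_of_ne h7, Function.update_of_ne h6]
    · rw [Nat.add_assoc, hm _ (hsq hx hy), if_neg (by omega)]
  · rintro i hi r₁ m₁ ⟨-, h₁, h6, h7, h8, hA, hz⟩
    have hi2 := hsq hi hi
    refine ⟨by rw [h6, h7, Nat.mul_succ]; omega, ?_⟩
    refine WP.store h₁.bdd fun hb => ?_
    refine WP.add hb (by rw [h6, h8, Nat.mul_succ]; omega) fun hb => ?_
    refine WP.seq_nil hb ⟨hi, h₁.frame hb fun x h6 _ _ _ => Function.update_of_ne h6 _ _, ?_,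
      by simp [h7], by simp [h8], ?_, ?_⟩
    · rw [Function.update_self, h6, h8, Nat.succ_mul, Nat.add_assoc]
    · intro x hx y hy
      rw [Function.update_apply, h6, h₁.r11, hA x hx y hy]
      by_cases e : M + x * n + y = M + i * (n + 1)
      · obtain ⟨rfl, rfl⟩ := mul_add_inj hy hi
          (show x * n + y = i * n + i by rw [Nat.mul_succ] at e; omega)
        rw [if_pos e, if_pos ⟨rfl, Nat.lt_succ_self _⟩]
      · rw [if_neg e]
        have : ¬ (x = y ∧ x = i) := by
          rintro ⟨rfl, rfl⟩
          exact e (by rw [Nat.mul_succ]; omega)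
        congr 1
        apply propext
        omega
    · intro a ha
      rw [Function.update_of_ne (by rw [h6, Nat.mul_succ]; omega), hz a ha]
  · rintro r₁ m₁ ⟨-, h₁, h6, h7, h8, hA, hz⟩
    refine ⟨by rw [h6, h7, Nat.mul_succ]; omega, ?_⟩
    refine ⟨h₁.bdd, h₁.r0, h₁.r1, h₁.r2, h₁.r3, h₁.r4, h₁.r5, h₁.r10, h₁.r11, h₁.r12, h₁.r13,
      fun x hx => h₁.free x (by omega), fun x hx y hy => ?_, hz, by simp⟩
    rw [hA x hx y hy]
    simp [hx]

theorem wp_erase (l : List ℕ) : ∀ {r : ℕ → ℕ}, Bdd B r m →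
    (seq (l.map fun x => set (x + 1) 0)).WP B l.length (fun r' m' => m' = m ∧
      ∀ x, r' x = if 1 ≤ x ∧ x - 1 ∈ l then 0 else r x) r m := by
  induction l with
  | nil => exact fun hb => WP.seq_nil hb ⟨rfl, by simp⟩
  | cons a l ih =>
    intro r hb
    refine WP.set hb (Nat.zero_le _) fun hb => ?_
    refine (ih hb).mono ?_ le_rfl
    rintro r' m' ⟨rfl, hr⟩
    refine ⟨rfl, fun x => ?_⟩
    rw [hr x, Function.update_apply]
    have : x = a + 1 ↔ 1 ≤ x ∧ x - 1 = a := by omega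
    simp only [this, List.mem_cons]
    split_ifs <;> first | rfl | tauto

/-- The memory of a string, with the coercion of the symbols to numbers written as a map. -/
theorem stringInput_mem {q : ℕ} (s : List (Fin q)) (a : ℕ) :
    (stringInput q).mem s a = (s[a]?.map Fin.val).getD 0 := by
  have : (s >>= fun x => pure (x : ℕ)) = s.map Fin.val := List.map_eq_flatMap.symm
  simp only [stringInput]
  rw [this]
  simp [Function.comp_def]

theorem wp_cleanProg {wt : ℕ → ℕ → ℕ} {out : List Sym} (h : St n k M B wt out r m)
    (hB : Enough n k M B) (hM : out.length = M) :
    (cleanProg k).WP B (n * n * 4 + k + 16) (fun r' m' => r' = (stringInput 7).reg out ∧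
      m' = (stringInput 7).mem out) r m := by
  unfold Enough at hB
  refine WP.add h.bdd (by rw [h.r3, h.r2]; omega) fun hb => ?_
  rw [h.r3, h.r2, Nat.add_zero] at hb ⊢
  refine WP.part (t' := k + 14) (WP.whileNe (t := 2) (n * n)
    (fun i r' m' => i ≤ n * n ∧ Bdd B r' m' ∧
      r' 6 = M + i ∧ (∀ y, y ≠ 6 → r' y = r y) ∧
      (∀ a < M, m' a = m a) ∧ (∀ a, M ≤ a → a < M + i → m' a = 0) ∧ ∀ a, M + n * n ≤ a → m' a = 0)
    (post := fun r' m' => Bdd B r' m' ∧ (∀ y, y ≠ 6 → r' y = r y) ∧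
      (∀ a < M, m' a = m a) ∧ ∀ a, M ≤ a → m' a = 0)
    (fun i r' m' h => h.2.1) ?_ ?_ ?_) (by omega) ?_
  · exact ⟨Nat.zero_le _, hb, by simp, fun y h6 => Function.update_of_ne h6 _ _, fun _ _ => rfl,
      by omega, h.beyond⟩
  · rintro i hi r₁ m₁ ⟨-, hb, h6, hr, h₁, h₂, h₃⟩
    refine ⟨by rw [h6, hr _ (by decide), h.r4]; omega, ?_⟩
    refine WP.store hb fun hb => ?_
    rw [hr 2 (by decide), h.r2, h6] at hb ⊢
    refine WP.add hb (by rw [h6, hr _ (by decide), h.r1]; omega) fun hb => ?_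
    refine WP.seq_nil hb ⟨hi, hb, ?_, ?_, ?_, ?_, ?_⟩
    · rw [Function.update_self, h6, hr _ (by decide), h.r1, Nat.add_assoc]
    · exact fun y hy => by rw [Function.update_of_ne hy, hr y hy]
    · exact fun a ha => by rw [Function.update_of_ne (by omega), h₁ a ha]
    · intro a ha ha'
      rw [Function.update_apply]
      split_ifs with e
      · rfl
      · exact h₂ a ha (by omega)
    · exact fun a ha => by rw [Function.update_of_ne (by omega), h₃ a ha]
  · rintro r₁ m₁ ⟨-, hb, h6, hr, h₁, h₂, h₃⟩
    refine ⟨by rw [h6, hr _ (by decide), h.r4], hb, hr, h₁, fun a ha => ?_⟩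
    rcases lt_or_ge a (M + n * n) with ha' | ha'
    exacts [h₂ a ha ha', h₃ a ha']
  rintro r₁ m₁ ⟨hb, hr, h₁, h₂⟩
  have h5 : r₁ 5 + r₁ 2 = M := by
    rw [hr _ (by decide), hr _ (by decide), h.r5, h.r2, hM, Nat.add_zero]
  refine WP.add hb (by rw [h5]; omega) fun hb => ?_
  rw [h5] at hb ⊢
  refine WP.part (t' := 0) (wp_erase _ hb).bdd (by simp; omega) ?_
  rintro r₂ m₂ ⟨⟨rfl, hr₂⟩, hb₂⟩
  refine WP.seq_nil hb₂ ⟨?_, ?_⟩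
  · funext x
    rw [hr₂ x, Function.update_apply]
    simp only [List.mem_range, stringInput]
    by_cases hx : x = 0
    · simp [hx, hM]
    · rw [if_neg hx, if_neg hx]
      split_ifs with hx'
      · rfl
      · rw [hr x (by omega), h.free x (by omega)]
  · funext a
    rw [stringInput_mem]
    rcases lt_or_ge a M with ha | ha
    · rw [h₁ a ha, h.output a _ (List.getElem?_eq_getElem (by omega)),
        List.getElem?_eq_getElem (by omega)]
      rfl
    · rw [h₂ a ha, List.getElem?_eq_none (by omega)]
      rfl

/-- The running time of the reduction. -/
def reductionTime (k n : ℕ) : ℕ :=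
  (k + 1) * (n * 4 + 4) + 13 + (n * n * 6 + 3) + (n * 4 + 4) + nestTime n k k +
    (n * n * 4 + k + 16)

/-- A bound for the numbers that occur in the reduction. -/
def reductionBound (k n : ℕ) : ℕ :=
  n ^ k * (4 * n + 3) + n * n + 5 * n + (k + 1) * (k + 1) + 7

theorem wp_reduction (hk : 1 ≤ k) (G : Graph) :
    (reduction k).WP (reductionBound k G.1) (reductionTime k G.1)
      (fun r m => r = (stringInput 7).reg (encode (graphWeight k G) G.1 k) ∧
        m = (stringInput 7).mem (encode (graphWeight k G) G.1 k))
      (graphInput.reg G) (graphInput.mem G) := by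
  have hB : Enough G.1 k (G.1 ^ k * (4 * G.1 + 3)) (reductionBound k G.1) := le_rfl
  have hM : G.1 * G.1 ≤ G.1 ^ k * (4 * G.1 + 3) :=
    Nat.mul_le_mul (Nat.le_self_pow (by omega) _) (by omega)
  have hB' := hB
  unfold Enough at hB'
  have hb : Bdd (reductionBound k G.1) (graphInput.reg G) (graphInput.mem G) := by
    refine ⟨fun i => ?_, fun a => (graphInput_mem_le_one G a).trans (by omega)⟩
    simp only [graphInput]
    split_ifs <;> omega
  unfold reductionTime
  refine WP.part (t' := (G.1 * G.1 * 6 + 3) + ((G.1 * 4 + 4) + (nestTime G.1 k k +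
    (G.1 * G.1 * 4 + k + 16)))) (wp_setupProg (n := G.1) (k := k)
    (fun x hx => by simp [graphInput, hx]) (by simp [graphInput]) hb hB) (by omega) ?_
  rintro r₁ m₁ ⟨rfl, h₁⟩
  refine WP.part (wp_copyProg h₁ hB hM fun a ha => graphInput_mem_eq_zero G ha) le_rfl ?_
  rintro r₂ m₂ ⟨h₂, hm, hm'⟩
  refine WP.part (wp_diagonalProg h₂ hB hm hm') le_rfl ?_
  intro r₃ m₃ h₃
  refine WP.part (wp_nestProg (pre := []) hB hk (graphWeight_le k G) k (by simp) (by simp) h₃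
    (by simp) (by intro l d hd; simp at hd)) le_rfl ?_
  rintro r₄ m₄ ⟨h₄, -⟩
  exact WP.part (t' := 0) (wp_cleanProg h₄ hB length_encode).bdd le_rfl
    fun r m h => WP.seq_nil h.2 h.1

end CliqueTAG

/-! ### Running times -/

namespace CliqueTAG

open RAM RAM.Program

theorem nestTime_le (n k j : ℕ) : nestTime n k j ≤ (12 * k + 75 + 3 * j) * (n + 1) ^ (j + 1) := by
  induction j with
  | zero =>
    simp only [nestTime, zero_add, pow_one, mul_zero, add_zero]
    nlinarith
  | succ j ih =>
    simp only [nestTime]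
    have h : 1 ≤ (n + 1) ^ (j + 1) := Nat.one_le_pow _ _ (by omega)
    calc n * (nestTime n k j + 3) + 2
        ≤ (n + 1) * (nestTime n k j + 3) := by nlinarith
      _ ≤ (n + 1) * ((12 * k + 75 + 3 * j) * (n + 1) ^ (j + 1) + 3 * (n + 1) ^ (j + 1)) :=
          Nat.mul_le_mul_left _ (by omega)
      _ = (12 * k + 75 + 3 * (j + 1)) * (n + 1) ^ (j + 1 + 1) := by ring

theorem reductionTime_le {k : ℕ} (hk : 1 ≤ k) (n : ℕ) :
    reductionTime k n ≤ (20 * k + 129) * (n + 1) ^ (k + 1) := by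
  have h1 : n + 1 ≤ (n + 1) ^ (k + 1) := Nat.le_self_pow (by omega) _
  have h2 : n * n ≤ (n + 1) ^ (k + 1) :=
    calc n * n ≤ (n + 1) ^ 2 := by nlinarith
      _ ≤ (n + 1) ^ (k + 1) := Nat.pow_le_pow_right (by omega) (by omega)
  have h3 := nestTime_le n k k
  have h4 : k * (n + 1) ≤ k * (n + 1) ^ (k + 1) := Nat.mul_le_mul_left k h1
  unfold reductionTime
  generalize (n + 1) ^ (k + 1) = x at *
  nlinarith

theorem le_pow_mul_log {k n : ℕ} (hn : 2 ≤ n) : n ^ (k + 1) ≤ n ^ (k + 1) * Nat.log 2 n :=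
  Nat.le_mul_of_pos_right _ (Nat.log_pos (by omega) hn)

theorem exists_reductionTime_le {k : ℕ} (hk : 1 ≤ k) :
    ∃ C, ∀ n, 2 ≤ n → reductionTime k n + n ^ k * (4 * n + 3) ≤
      C * (n ^ (k + 1) * Nat.log 2 n) := by
  refine ⟨(20 * k + 129) * 2 ^ (k + 1) + 7, fun n hn => ?_⟩
  have h1 : (n + 1) ^ (k + 1) ≤ 2 ^ (k + 1) * n ^ (k + 1) := by
    rw [← mul_pow]
    exact Nat.pow_le_pow_left (by omega) _
  have h2 : n ^ k * (4 * n + 3) ≤ 7 * n ^ (k + 1) := by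
    rw [pow_succ, mul_left_comm]
    exact Nat.mul_le_mul_left _ (by omega)
  calc reductionTime k n + n ^ k * (4 * n + 3)
      ≤ (20 * k + 129) * (2 ^ (k + 1) * n ^ (k + 1)) + 7 * n ^ (k + 1) :=
        add_le_add ((reductionTime_le hk n).trans (Nat.mul_le_mul_left _ h1)) h2
    _ = ((20 * k + 129) * 2 ^ (k + 1) + 7) * n ^ (k + 1) := by ring
    _ ≤ _ := Nat.mul_le_mul_left _ (le_pow_mul_log hn)

theorem isBigO_reductionTime {k : ℕ} (hk : 1 ≤ k) :
    (fun n => ((reductionTime k n + n ^ k * (4 * n + 3) : ℕ) : ℝ)) =O[atTop]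
      fun n => ((n ^ (k + 1) * Nat.log 2 n : ℕ) : ℝ) := by
  obtain ⟨C, hC⟩ := exists_reductionTime_le hk
  refine IsBigO.of_bound C (eventually_atTop.2 ⟨2, fun n hn => ?_⟩)
  rw [Real.norm_natCast, Real.norm_natCast]
  exact_mod_cast hC n hn

/-- The string has length `O(n ^ (k + 1))`, so that it is eventually no longer than
`n ^ (k + 1) * Nat.log 2 n`, without a constant factor. A constant factor would not do: `T (C * N)`
need not be `O(T N)` for a monotone `T`. -/
theorem length_le_pow_mul_log {k n : ℕ} (hn : 128 ≤ n) :
    n ^ k * (4 * n + 3) ≤ n ^ (k + 1) * Nat.log 2 n := by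
  have h7 : 7 ≤ Nat.log 2 n := Nat.le_log_of_pow_le (by omega) (by simpa using hn)
  calc n ^ k * (4 * n + 3) ≤ n ^ k * (n * 7) := Nat.mul_le_mul_left _ (by omega)
    _ = n ^ (k + 1) * 7 := by ring
    _ ≤ _ := Nat.mul_le_mul_left _ h7

theorem exists_reductionBound_le {k : ℕ} (hk : 1 ≤ k) :
    ∃ c, ∀ n, reductionBound k n ≤ (n + 2) ^ c := by
  refine ⟨(k + 1) * (k + 1) + 17 + (k + 1), fun n => ?_⟩
  have h1 : 1 ≤ (n + 2) ^ (k + 1) := Nat.one_le_pow _ _ (by omega)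
  have h2 : n * n ≤ (n + 2) ^ (k + 1) :=
    calc n * n ≤ (n + 2) ^ 2 := by nlinarith
      _ ≤ (n + 2) ^ (k + 1) := Nat.pow_le_pow_right (by omega) (by omega)
  have h3 : n ≤ (n + 2) ^ (k + 1) := (Nat.le_add_right n 2).trans (Nat.le_self_pow (by omega) _)
  have h4 : n ^ k * (4 * n + 3) ≤ 4 * (n + 2) ^ (k + 1) := by
    rw [pow_succ, mul_left_comm]
    exact Nat.mul_le_mul (Nat.pow_le_pow_left (by omega) _) (by omega)
  calc reductionBound k n ≤ ((k + 1) * (k + 1) + 17) * (n + 2) ^ (k + 1) := by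
        unfold reductionBound
        generalize (n + 2) ^ (k + 1) = x at *
        nlinarith [Nat.mul_le_mul_left ((k + 1) * (k + 1)) h1]
    _ ≤ (n + 2) ^ ((k + 1) * (k + 1) + 17) * (n + 2) ^ (k + 1) :=
        Nat.mul_le_mul_right _ ((Nat.lt_two_pow_self).le.trans (Nat.pow_le_pow_left (by omega) _))
    _ = _ := (pow_add _ _ _).symm

end CliqueTAG

namespace RAM

namespace Program

theorem WP.run {P : Program} {B t T : ℕ} {post : (ℕ → ℕ) → (ℕ → ℕ) → Prop} {r m : ℕ → ℕ}
    (h : P.WP B t post r m) (hT : t ≤ T) : P.Halted (P.run T ⟨0, r, m⟩) ∧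
      post (P.run T ⟨0, r, m⟩).reg (P.run T ⟨0, r, m⟩).mem ∧
      ∀ j, (P.run j ⟨0, r, m⟩).BoundedBy B := by
  obtain ⟨r', m', pc, hpc, hr, hq⟩ := h
  have hb := hr.boundedBy hpc
  obtain ⟨j, hj, hr, -⟩ := hr
  have : P.run T ⟨0, r, m⟩ = ⟨pc, r', m'⟩ := by
    obtain ⟨d, rfl⟩ := Nat.exists_eq_add_of_le (hj.trans hT)
    rw [run_add, hr]
    exact Halted.run_eq (c := ⟨pc, r', m'⟩) hpc d
  rw [this]
  exact ⟨hpc, hq, hb⟩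

open Classical in
theorem DecidesInTime.exists_wp {α : Type} {P : Program} {e : Input α} {A : Set α} {t : ℕ → ℕ}
    (h : P.DecidesInTime e A t) : ∃ c, ∀ x, P.WP ((e.size x + 2) ^ c) (t (e.size x))
      (fun r _ => r 0 = if x ∈ A then 1 else 0) (e.reg x) (e.mem x) := by
  obtain ⟨⟨c, hc⟩, h⟩ := h
  exact ⟨c, fun x => ⟨_, _, _, (h x).1, ⟨_, le_rfl, rfl, fun i _ => hc x i⟩, (h x).2⟩⟩

end Program

end RAM

open CliqueTAG RAM RAM.Program in
/-- One grammar `Γ` serves all `k ≥ 1`. For each `k` there is one reduction program `R`, which does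
not depend on the recogniser `P` nor on its running time `T`: it turns a graph into a string with a
few additions, subtractions, comparisons and memory accesses per symbol, and then `P` is run once
on that string. -/
theorem mainTheorem1 :
    ∃ (q p : ℕ) (Γ : TreeAdj.TAG (Fin q) (Fin p)), ∀ k : ℕ, 1 ≤ k →
      ∃ R : RAM.Program, R.IsAdditive ∧
        (∃ (enc : RAM.Graph → List (Fin q)) (t : ℕ → ℕ),
          (∀ G, enc G ∈ Γ.language ↔ G ∈ RAM.cliqueProblem (6 * k)) ∧
          (∀ G, (enc G).length ≤ t G.1) ∧
          R.ComputesInTime RAM.graphInput (RAM.stringInput q) enc t ∧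
          (fun n => (t n : ℝ)) =O[atTop] fun n => ((n ^ (k + 1) * Nat.log 2 n : ℕ) : ℝ)) ∧
        ∀ (T : ℕ → ℕ) (P : RAM.Program), Monotone T →
          ((fun n : ℕ => (n : ℝ)) =O[atTop] fun n : ℕ => (T n : ℝ)) →
          P.DecidesInTime (RAM.stringInput q) Γ.language T →
          ∃ t : ℕ → ℕ,
            (R.andThen P).DecidesInTime RAM.graphInput (RAM.cliqueProblem (6 * k)) t ∧
            (fun n => (t n : ℝ)) =O[atTop]
              fun n => (T (n ^ (k + 1) * Nat.log 2 n) : ℝ) := by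
  classical
  refine ⟨7, 4, grammar, fun k hk => ⟨reduction k, isAdditive_reduction k, ?_, ?_⟩⟩
  · obtain ⟨c, hc⟩ := exists_reductionBound_le hk
    refine ⟨fun G => encode (graphWeight k G) G.1 k,
      fun n => reductionTime k n + n ^ k * (4 * n + 3), encode_mem_language_iff hk,
      fun G => length_encode.le.trans (Nat.le_add_left _ _), ⟨⟨c, fun G j => ?_⟩, fun G => ?_⟩,
      isBigO_reductionTime hk⟩
    · exact (((wp_reduction hk G).mono_bound (hc G.1)).run le_rfl).2.2 j
    · obtain ⟨h₁, ⟨h₂, h₃⟩, -⟩ := (wp_reduction hk G).run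
        (Nat.le_add_right (reductionTime k G.1) (G.1 ^ k * (4 * G.1 + 3)))
      exact ⟨h₁, h₂, h₃⟩
  · intro T P hmono hT hP
    obtain ⟨c₁, hc₁⟩ := exists_reductionBound_le hk
    obtain ⟨c₂, hc₂⟩ := hP.exists_wp
    have hwp : ∀ G : Graph, ((reduction k).andThen P).WP ((G.1 + 2) ^ (c₁ + c₁ * c₂))
        (reductionTime k G.1 + T (G.1 ^ k * (4 * G.1 + 3)))
        (fun r _ => r 0 = if G ∈ cliqueProblem (6 * k) then 1 else 0)
        (graphInput.reg G) (graphInput.mem G) := by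
      intro G
      refine WP.andThen (((wp_reduction hk G).mono_bound ?_).mono ?_ le_rfl)
      · exact (hc₁ G.1).trans (Nat.pow_le_pow_right (by omega) (by omega))
      · rintro r m ⟨rfl, rfl⟩
        have h := hc₂ (encode (graphWeight k G) G.1 k)
        have hiff : (encode (graphWeight k G) G.1 k ∈ (show Set (List Sym) from grammar.language)) ↔
          G ∈ cliqueProblem (6 * k) := encode_mem_language_iff hk G
        simp only [hiff] at h
        have hs : (stringInput 7).size (encode (graphWeight k G) G.1 k) =
          G.1 ^ k * (4 * G.1 + 3) := length_encode
        rw [hs] at h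
        refine h.mono_bound ?_
        have hlen : G.1 ^ k * (4 * G.1 + 3) + 2 ≤ reductionBound k G.1 := by
          unfold reductionBound
          omega
        calc (G.1 ^ k * (4 * G.1 + 3) + 2) ^ c₂ ≤ ((G.1 + 2) ^ c₁) ^ c₂ :=
              Nat.pow_le_pow_left (hlen.trans (hc₁ G.1)) _
          _ = (G.1 + 2) ^ (c₁ * c₂) := (pow_mul _ _ _).symm
          _ ≤ _ := Nat.pow_le_pow_right (by omega) (by omega)
    refine ⟨fun n => reductionTime k n + T (n ^ k * (4 * n + 3)),
      ⟨⟨c₁ + c₁ * c₂, fun G => ((hwp G).run le_rfl).2.2⟩, fun G => ?_⟩, ?_⟩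
    · obtain ⟨h₁, h₂, -⟩ := (hwp G).run le_rfl
      exact ⟨h₁, h₂⟩
    · have htop : Tendsto (fun n : ℕ => n ^ (k + 1) * Nat.log 2 n) atTop atTop :=
        tendsto_atTop_mono' atTop (eventually_atTop.2 ⟨2, fun n hn =>
          (Nat.le_self_pow (by omega) n).trans (le_pow_mul_log hn)⟩) tendsto_id
      have hR : (fun n => (reductionTime k n : ℝ)) =O[atTop]
          fun n => (T (n ^ (k + 1) * Nat.log 2 n) : ℝ) := by
        refine IsBigO.trans (IsBigO.trans (IsBigO.of_bound 1 (Eventually.of_forall fun n => ?_))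
          (isBigO_reductionTime hk)) (hT.comp_tendsto htop)
        rw [Real.norm_natCast, Real.norm_natCast, one_mul]
        exact_mod_cast Nat.le_add_right _ _
      have hT' : (fun n => (T (n ^ k * (4 * n + 3)) : ℝ)) =O[atTop]
          fun n => (T (n ^ (k + 1) * Nat.log 2 n) : ℝ) := by
        refine IsBigO.of_bound 1 (eventually_atTop.2 ⟨128, fun n hn => ?_⟩)
        rw [Real.norm_natCast, Real.norm_natCast, one_mul]
        exact_mod_cast hmono (length_le_pow_mul_log hn)
      simpa using hR.add hT'
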